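/- Consider the multivariate linear regression model $y_i = B^\top x_i + \varepsilon_i$, $i=1,\dots,n$, where $\varepsilon_1,\dots,\varepsilon_n \sim \mathrm{N}_q(0,\Sigma)$ are independent, $q \ge 1$, $\Sigma \in \mathbb{R}^{q\times q}$ is a known positive definite matrix, $B \in \mathbb{R}^{p\times q}$ is unknown, and $X=(x_1,\dots,x_n)^\top \in \mathbb{R}^{n\times p}$ is a known design matrix such that $X^\top X$ is invertible (so $n \ge p$). Write $Y=(y_1,\dots,y_n)^\top$ and let $\hat B = (X^\top X)^{-1}X^\top Y$ be the maximum likelihood estimate of $B$. Consider the estimator $\hat M = X\hat B$ of $M = XB$ under the loss $L(M,\hat M) = \mathrm{tr}(\Sigma^{-1}(\hat M-M)^\top(\hat M-M))$. A loss estimator is a measurable function $\lambda:\mathbb{R}^{n\times q}\to\mathbb{R}$. A loss estimator $\lambda_1$ dominates $\lambda_2$ if $\mathrm{E}_B[(\lambda_1(Y)-L(M,\hat M))^2] \le \mathrm{E}_B[(\lambda_2(Y)-L(M,\hat M))^2]$ for every $B\in\mathbb{R}^{p\times q}$, with strict inequality for at least one $B$; a loss estimator is inadmissible if some loss estimator dominates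 it. For an estimator of the form $\hat M(Y)=Y+g(Y)$, Stein's unbiased risk estimate (SURE) is $$\lambda^{\mathrm U}(Y) = nq + 2\sum_{i,j}\frac{\partial g_{ij}}{\partial Y_{ij}}(Y) + \mathrm{tr}(\Sigma^{-1}g(Y)^\top g(Y)).$$ Suppose that $p \ge 2q+3$. Then SURE for $\hat M = X\hat B$ is $$\lambda^{\mathrm U}(Y) = \mathrm{tr}(\Sigma^{-1}(Y-X\hat B)^\top(Y-X\hat B)) + (2p-n)q ,$$ and it is inadmissible and dominated by the loss estimator $$\lambda(Y) = \lambda^{\mathrm U}(Y) - \frac{2(p-2q-2)}{q}\,\mathrm{tr}\big(\Sigma((X\hat B)^\top (X\hat B))^{-1}\big).$$ -/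

import Mathlib

open MeasureTheory ProbabilityTheory Matrix
open scoped ENNReal

/-- Real matrices carry the product σ-algebra of their entries. -/
instance Matrix.instMeasurableSpaceReal {m n : Type*} : MeasurableSpace (Matrix m n ℝ) :=
  inferInstanceAs (MeasurableSpace (m → n → ℝ))

namespace LossEstimation

section General

/-- The mean squared error `E_θ[(l(Y) - L(θ, Y))²]` of a loss estimator `l`, as an extended
nonnegative number.  Here `P θ` is the law of the observation `Y` under the parameter `θ`, and
`L θ y` is the realized loss (the loss of the underlying point estimate computed from `y`). -/
noncomputable def mse {Θ 𝒴 : Type*} [MeasurableSpace 𝒴] (P : Θ → Measure 𝒴) (L : Θ → 𝒴 → ℝ)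
    (l : 𝒴 → ℝ) (θ : Θ) : ℝ≥0∞ :=
  ∫⁻ y, ENNReal.ofReal ((l y - L θ y) ^ 2) ∂(P θ)

/-- The loss estimator `l₁` dominates `l₂`. -/
def Dominates {Θ 𝒴 : Type*} [MeasurableSpace 𝒴] (P : Θ → Measure 𝒴) (L : Θ → 𝒴 → ℝ)
    (l₁ l₂ : 𝒴 → ℝ) : Prop :=
  (∀ θ, mse P L l₁ θ ≤ mse P L l₂ θ) ∧ ∃ θ, mse P L l₁ θ < mse P L l₂ θ

/-- A loss estimator is inadmissible if some (measurable) loss estimator dominates it. -/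
def Inadmissible {Θ 𝒴 : Type*} [MeasurableSpace 𝒴] (P : Θ → Measure 𝒴) (L : Θ → 𝒴 → ℝ)
    (l : 𝒴 → ℝ) : Prop :=
  ∃ l' : 𝒴 → ℝ, Measurable l' ∧ Dominates P L l' l

end General

section Regression

variable {n p q : ℕ}

/-- The law of `Y = (y₁, …, yₙ)ᵀ` in the multivariate linear regression model
`yᵢ = Bᵀ xᵢ + εᵢ` with independent errors `εᵢ ∼ N_q(0, Σ)`, where `xᵢ` is the `i`-th row of `X`. -/
noncomputable def regressionLaw (X : Matrix (Fin n) (Fin p) ℝ) (S : Matrix (Fin q) (Fin q) ℝ)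
    (B : Matrix (Fin p) (Fin q) ℝ) : Measure (Matrix (Fin n) (Fin q) ℝ) :=
  (Measure.pi fun _ : Fin n => multivariateGaussian (0 : EuclideanSpace ℝ (Fin q)) S).map
    fun ε => Matrix.of fun i j => (Bᵀ *ᵥ X i) j + ε i j

/-- The maximum likelihood estimate `B̂ = (XᵀX)⁻¹ Xᵀ Y`. -/
noncomputable def mle (X : Matrix (Fin n) (Fin p) ℝ) (Y : Matrix (Fin n) (Fin q) ℝ) :
    Matrix (Fin p) (Fin q) ℝ :=
  (Xᵀ * X)⁻¹ * Xᵀ * Y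

/-- The loss `L(M, M̂) = tr(Σ⁻¹ (M̂ - M)ᵀ (M̂ - M))`. -/
noncomputable def quadLoss (S : Matrix (Fin q) (Fin q) ℝ) (M Mhat : Matrix (Fin n) (Fin q) ℝ) : ℝ :=
  (S⁻¹ * (Mhat - M)ᵀ * (Mhat - M)).trace

/-- Stein's unbiased risk estimate of an estimator `M̂(Y) = Y + g(Y)` of `M`, for
`Y ∼ N_{n,q}(M, Iₙ, Σ)` and the loss `quadLoss Σ`:
`λᵁ(Y) = nq + 2 ∑ᵢⱼ ∂gᵢⱼ/∂Yᵢⱼ (Y) + tr(Σ⁻¹ g(Y)ᵀ g(Y))`. -/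
noncomputable def sure (S : Matrix (Fin q) (Fin q) ℝ)
    (Mhat : Matrix (Fin n) (Fin q) ℝ → Matrix (Fin n) (Fin q) ℝ)
    (Y : Matrix (Fin n) (Fin q) ℝ) : ℝ :=
  let g : Matrix (Fin n) (Fin q) ℝ → Matrix (Fin n) (Fin q) ℝ := fun Z => Mhat Z - Z
  (n : ℝ) * q + 2 * (∑ i, ∑ j, deriv (fun t : ℝ => g (Y + t • Matrix.single i j (1 : ℝ)) i j) 0)
    + (S⁻¹ * (g Y)ᵀ * g Y).trace

/-- The loss estimator
`λ(Y) = λᵁ(Y) - (2(p - 2q - 2)/q) tr(Σ ((XB̂)ᵀ(XB̂))⁻¹)` for the estimator `M̂ = XB̂`. -/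
noncomputable def modifiedSure (X : Matrix (Fin n) (Fin p) ℝ) (S : Matrix (Fin q) (Fin q) ℝ)
    (Y : Matrix (Fin n) (Fin q) ℝ) : ℝ :=
  sure S (fun Z => X * mle X Z) Y
    - 2 * ((p : ℝ) - 2 * q - 2) / q * (S * ((X * mle X Y)ᵀ * (X * mle X Y))⁻¹).trace

end Regression

end LossEstimation

/-! Write `Y = XB + N R` with `R = Σ^{1/2}` and `N` standard Gaussian, and let `P` be the orthogonal
projection onto the columns of `X`, of trace `p`. The error of SURE is then the quadratic form `D =
tr(Nᵀ(1 - 2P)N) + (2p - n)q`, and the correction is `c T` with `T = tr (ZᵀZ)⁻¹`, `Z = XBR⁻¹ + PN`,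
`c = 2(p - 2q - 2)/q`. If `c E T² ≤ E[T D]`, expanding the square shows that the correction lowers
`E D²` by at least `c² E T²`.

To avoid the singularity of `T`, replace it by `t = tr G`, `G = (ZᵀZ + ε)⁻¹`, whose entries are
bounded by `1/ε`. Stein's lemma applied to `t (1 - 2P) N` gives `E[t D] = 2 E tr(Nᵀ Z G²)`, because
`1 - 2P` acts as `-1` on `Z` and the constant in `D` cancels the divergence of `(1 - 2P) N`. Applied
to `Z G²`, it turns this into `2 E[(p - q - 2) tr G² - (tr G)²]` plus nonnegative multiples of `ε`.
Since `(tr G)² ≤ q tr G²`, this is at least `c E t²` (`le_integral_trace_gramResolvent_mul`).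

Letting `ε → 0`, Fatou's lemma is used twice (`lintegral_sub_sq_lt`): the bounded second moments of
`t` force `ZᵀZ` to be invertible almost surely, and the surplus `c² E T² > 0` survives the limit and
makes the inequality strict. -/

/-! ### Stein's lemma for one Gaussian coordinate -/

/-- **Stein's lemma** for the standard Gaussian distribution on the line. -/
theorem integral_id_mul_gaussianReal {f f' : ℝ → ℝ} (hf : ∀ x, HasDerivAt f (f' x) x)
    (hfi : Integrable f (gaussianReal 0 1)) (hfi' : Integrable f' (gaussianReal 0 1))
    (hxf : Integrable (fun x => x * f x) (gaussianReal 0 1)) :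
    ∫ x, x * f x ∂gaussianReal 0 1 = ∫ x, f' x ∂gaussianReal 0 1 := by
  have key : ∀ g : ℝ → ℝ, Integrable g (gaussianReal 0 1) →
      Integrable (fun x => g x * gaussianPDFReal 0 1 x) := by
    intro g hg
    rw [gaussianReal_of_var_ne_zero 0 one_ne_zero] at hg
    rw [integrable_withDensity_iff (measurable_gaussianPDF 0 1)
      (Filter.Eventually.of_forall fun _ => gaussianPDF_lt_top)] at hg
    simpa [toReal_gaussianPDF] using hg
  have hφ : ∀ x, HasDerivAt (gaussianPDFReal 0 1) (-x * gaussianPDFReal 0 1 x) x := by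
    intro x
    have h1 : HasDerivAt (fun x : ℝ => -(x - 0) ^ 2 / (2 * ((1 : NNReal) : ℝ))) (-x) x := by
      have := (((hasDerivAt_id x).sub_const 0).pow 2).neg.div_const (2 * ((1 : NNReal) : ℝ))
      refine this.congr_deriv ?_
      simp
      ring
    have h2 := h1.exp.const_mul (Real.sqrt (2 * Real.pi * ((1 : NNReal) : ℝ)))⁻¹
    refine h2.congr_deriv ?_
    simp only [gaussianPDFReal]
    ring
  -- Integration by parts against the density `φ`, with `φ' = -xφ`; integrability of the three
  -- products makes the boundary terms vanish.
  have hI := integral_mul_deriv_eq_deriv_mul_of_integrable (u := f) (u' := f')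
    (v := gaussianPDFReal 0 1) (v' := fun x => -x * gaussianPDFReal 0 1 x)
    (fun x _ => hf x) (fun x _ => hφ x)
    (by
      refine ((key _ hxf).neg).congr (Filter.Eventually.of_forall fun x => ?_)
      simp only [Pi.neg_apply, Pi.mul_apply]
      ring)
    (key _ hfi') (key _ hfi)
  rw [integral_gaussianReal_eq_integral_smul one_ne_zero,
    integral_gaussianReal_eq_integral_smul one_ne_zero]
  simp only [smul_eq_mul]
  calc ∫ x, gaussianPDFReal 0 1 x * (x * f x)
      = -∫ x, f x * (-x * gaussianPDFReal 0 1 x) := by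
        rw [← integral_neg]
        congr 1; ext x; ring
    _ = _ := by
        rw [hI, neg_neg]
        congr 1; ext x; ring

/-- Resampling one coordinate of a product measure does not change the measure. -/
theorem measurePreserving_update_pi {ι : Type*} [Fintype ι] [DecidableEq ι] {α : ι → Type*}
    [∀ i, MeasurableSpace (α i)] (μ : ∀ i, Measure (α i)) [∀ i, IsProbabilityMeasure (μ i)]
    (i : ι) :
    MeasurePreserving (fun z : α i × (∀ j, α j) => Function.update z.2 i z.1)
      ((μ i).prod (Measure.pi μ)) (Measure.pi μ) := by
  have hm : Measurable (fun z : α i × (∀ j, α j) => Function.update z.2 i z.1) := by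
    rw [measurable_pi_iff]
    intro j
    by_cases h : j = i
    · subst h
      simpa using measurable_fst
    · simp only [Function.update_of_ne h]
      exact (measurable_pi_apply j).comp measurable_snd
  refine ⟨hm, (Measure.pi_eq fun s hs => ?_).symm⟩
  rw [Measure.map_apply hm (MeasurableSet.univ_pi hs)]
  -- The old coordinate `i` is overwritten, hence unconstrained, and contributes a factor of mass
  -- one.
  have : (fun z : α i × (∀ j, α j) => Function.update z.2 i z.1) ⁻¹' Set.univ.pi s =
      s i ×ˢ Set.univ.pi (Function.update s i Set.univ) := by
    ext ⟨x, w⟩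
    simp only [Set.mem_preimage, Set.mem_univ_pi, Set.mem_prod]
    constructor
    · intro h
      refine ⟨by simpa using h i, fun j => ?_⟩
      by_cases hj : j = i
      · subst hj; simp
      · simpa [Function.update_of_ne hj] using h j
    · rintro ⟨h1, h2⟩ j
      by_cases hj : j = i
      · subst hj; simpa using h1
      · simpa [Function.update_of_ne hj] using h2 j
  rw [this, Measure.prod_prod, Measure.pi_pi, ← Finset.mul_prod_erase _ _ (Finset.mem_univ i),
    ← Finset.mul_prod_erase Finset.univ (fun j => μ j (s j)) (Finset.mem_univ i)]
  simp only [Function.update_self, measure_univ, one_mul]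
  congr 1
  refine Finset.prod_congr rfl fun j hj => ?_
  rw [Function.update_of_ne (Finset.ne_of_mem_erase hj)]

/-- **Stein's lemma** for one coordinate of a standard Gaussian vector. -/
theorem integral_eval_mul_pi_gaussianReal {ι : Type*} [Fintype ι] [DecidableEq ι] (i : ι)
    {f f' : (ι → ℝ) → ℝ}
    (hf : ∀ w, HasDerivAt (fun s : ℝ => f (w + s • Pi.single i (1 : ℝ))) (f' w) 0)
    (hfi : Integrable f (Measure.pi fun _ => gaussianReal 0 1))
    (hfi' : Integrable f' (Measure.pi fun _ => gaussianReal 0 1))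
    (hxf : Integrable (fun w => w i * f w) (Measure.pi fun _ => gaussianReal 0 1)) :
    ∫ w, w i * f w ∂(Measure.pi fun _ => gaussianReal 0 1) =
      ∫ w, f' w ∂(Measure.pi fun _ => gaussianReal 0 1) := by
  have hp := measurePreserving_update_pi (fun _ : ι => gaussianReal 0 1) i
  have resample : ∀ g : (ι → ℝ) → ℝ, Integrable g (Measure.pi fun _ => gaussianReal 0 1) →
      Integrable (fun z : ℝ × (ι → ℝ) => g (Function.update z.2 i z.1))
        ((gaussianReal 0 1).prod (Measure.pi fun _ => gaussianReal 0 1)) ∧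
      ∫ w, g w ∂(Measure.pi fun _ => gaussianReal 0 1) =
        ∫ w, ∫ x, g (Function.update w i x) ∂gaussianReal 0 1
          ∂(Measure.pi fun _ => gaussianReal 0 1) := by
    intro g hg
    have h1 : Integrable (fun z : ℝ × (ι → ℝ) => g (Function.update z.2 i z.1))
        ((gaussianReal 0 1).prod (Measure.pi fun _ => gaussianReal 0 1)) :=
      hp.integrable_comp_of_integrable hg
    refine ⟨h1, ?_⟩
    rw [← integral_prod_symm _ h1]
    conv_lhs => rw [← hp.map_eq]
    exact integral_map hp.measurable.aemeasurable (by rw [hp.map_eq]; exact hg.1)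
  rw [(resample _ hxf).2, (resample _ hfi').2]
  refine integral_congr_ae ?_
  filter_upwards [(resample _ hfi).1.prod_left_ae, (resample _ hfi').1.prod_left_ae,
    (resample _ hxf).1.prod_left_ae] with w h1 h2 h3
  simp only [Function.update_self] at h3 ⊢
  refine integral_id_mul_gaussianReal (fun x => ?_) h1 h2 h3
  have h := hf (Function.update w i x)
  -- With `0` written as `x - x`, the chain rule moves the derivative at `0` along the line to a
  -- derivative in the coordinate at `x`.
  rw [← sub_self x] at h
  have h' := HasDerivAt.comp (h := fun y => y - x) x h ((hasDerivAt_id x).sub_const x)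
  rw [mul_one] at h'
  refine h'.congr_of_eventuallyEq (Filter.Eventually.of_forall fun y => ?_)
  simp only [Function.comp]
  congr 1
  ext j
  by_cases hj : j = i
  · subst hj; simp
  · simp [hj]

/-! ### Variables with all moments finite -/

/-- A random variable whose moments of every order are finite. -/
def HasAllMoments {Ω : Type*} [MeasurableSpace Ω] (f : Ω → ℝ) (μ : Measure Ω) : Prop :=
  ∀ r : ℝ≥0∞, r ≠ ∞ → MemLp f r μ

namespace HasAllMoments

variable {Ω : Type*} [MeasurableSpace Ω] {μ : Measure Ω} {f g : Ω → ℝ}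

theorem integrable (hf : HasAllMoments f μ) : Integrable f μ :=
  memLp_one_iff_integrable.1 (hf 1 ENNReal.one_ne_top)

theorem add (hf : HasAllMoments f μ) (hg : HasAllMoments g μ) :
    HasAllMoments (fun x => f x + g x) μ :=
  fun r hr => (hf r hr).add (hg r hr)

theorem sub (hf : HasAllMoments f μ) (hg : HasAllMoments g μ) :
    HasAllMoments (fun x => f x - g x) μ :=
  fun r hr => (hf r hr).sub (hg r hr)

theorem neg (hf : HasAllMoments f μ) : HasAllMoments (fun x => -f x) μ :=
  fun r hr => (hf r hr).neg

/-- Hölder with exponents `2r, 2r`. Closure under products is the reason for asking for all moments: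
every integrand below is a polynomial in Gaussian entries and bounded ones. -/
theorem mul (hf : HasAllMoments f μ) (hg : HasAllMoments g μ) :
    HasAllMoments (fun x => f x * g x) μ := by
  intro r hr
  have : ENNReal.HolderTriple (2 * r) (2 * r) r := by
    constructor
    rw [ENNReal.mul_inv (by simp) (by simp), ← add_mul, ENNReal.inv_two_add_inv_two, one_mul]
  have h2 : 2 * r ≠ ∞ := ENNReal.mul_ne_top (by simp) hr
  exact (hg _ h2).mul (hf _ h2)

theorem const [IsFiniteMeasure μ] (c : ℝ) : HasAllMoments (fun _ => c) μ :=
  fun _ _ => memLp_const c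

theorem sum {ι : Type*} (s : Finset ι) {f : ι → Ω → ℝ} (hf : ∀ i ∈ s, HasAllMoments (f i) μ) :
    HasAllMoments (fun x => ∑ i ∈ s, f i x) μ :=
  fun r hr => memLp_finsetSum s fun i hi => hf i hi r hr

theorem of_bound [IsFiniteMeasure μ] (hf : Measurable f) (C : ℝ) (hC : ∀ x, |f x| ≤ C) :
    HasAllMoments f μ :=
  fun _ _ => MemLp.of_bound hf.aestronglyMeasurable C (ae_of_all _ hC)

theorem matrix_mul {l m n : Type*} [Fintype m] {U : Ω → Matrix l m ℝ} {V : Ω → Matrix m n ℝ}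
    (hU : ∀ i j, HasAllMoments (fun x => U x i j) μ)
    (hV : ∀ i j, HasAllMoments (fun x => V x i j) μ) (i : l) (j : n) :
    HasAllMoments (fun x => (U x * V x) i j) μ := by
  simp only [Matrix.mul_apply]
  exact sum _ fun k _ => (hU i k).mul (hV k j)

theorem trace {m : Type*} [Fintype m] {U : Ω → Matrix m m ℝ}
    (hU : ∀ i j, HasAllMoments (fun x => U x i j) μ) :
    HasAllMoments (fun x => (U x).trace) μ :=
  sum _ fun k _ => hU k k

theorem eval_pi_gaussianReal {ι : Type*} [Fintype ι] (i : ι) :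
    HasAllMoments (fun w : ι → ℝ => w i) (Measure.pi fun _ => gaussianReal 0 1) :=
  fun r hr => (memLp_id_gaussianReal' r hr).comp_measurePreserving
    (measurePreserving_eval (fun _ : ι => gaussianReal 0 1) i)

end HasAllMoments

/-! ### Derivatives and measurability of matrix products and inverses -/

section InverseDeriv

attribute [local instance] Matrix.linftyOpNormedRing Matrix.linftyOpNormedAlgebra

/-- The derivative of the inverse of a differentiable curve of invertible matrices. -/
theorem hasDerivAt_matrix_inv {k : Type*} [Fintype k] [DecidableEq k] {K : ℝ → Matrix k k ℝ}
    {K' : Matrix k k ℝ} {x : ℝ} (hK : ∀ a b, HasDerivAt (fun s => K s a b) (K' a b) x)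
    (hx : IsUnit (K x)) (a b : k) :
    HasDerivAt (fun s => (K s)⁻¹ a b) (-((K x)⁻¹ * K' * (K x)⁻¹) a b) x := by
  have h1 : HasDerivAt K K' x := by
    refine hasDerivAt_pi.2 fun a => ?_
    exact hasDerivAt_pi.2 fun b => hK a b
  obtain ⟨u, hu⟩ := hx
  have h2 := hasFDerivAt_ringInverse (𝕜 := ℝ) u
  rw [hu] at h2
  have h3 := h2.comp_hasDerivAt x h1
  have h4 := hasDerivAt_pi.1 (hasDerivAt_pi.1 h3 a) b
  refine (h4.congr_deriv ?_).congr_of_eventuallyEq (Filter.Eventually.of_forall fun s => ?_)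
  · have : ((u⁻¹ : (Matrix k k ℝ)ˣ) : Matrix k k ℝ) = (K x)⁻¹ := by
      rw [← hu, Matrix.coe_units_inv]
    rw [← this]
    rfl
  · simp only [Function.comp]
    rw [← Matrix.nonsing_inv_eq_ringInverse]

end InverseDeriv

/-- Cramer's rule: an adjugate entry is a polynomial and is divided by the determinant, which is
harmless at singular matrices because `0⁻¹ = 0`. -/
theorem measurable_matrix_inv_apply {Ω k : Type*} [MeasurableSpace Ω] [Fintype k] [DecidableEq k]
    {K : Ω → Matrix k k ℝ} (hK : ∀ a b, Measurable fun x => K x a b) (a b : k) :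
    Measurable fun x => (K x)⁻¹ a b := by
  have hd : ∀ (L : Ω → Matrix k k ℝ), (∀ a b, Measurable fun x => L x a b) →
      Measurable fun x => (L x).det := by
    intro L hL
    simp only [Matrix.det_apply]
    exact Finset.measurable_sum _ fun σ _ =>
      (Finset.measurable_prod _ fun i _ => hL _ _).const_smul _
  simp only [Matrix.inv_def, Matrix.smul_apply, Ring.inverse_eq_inv', smul_eq_mul]
  refine (hd K hK).inv.mul ?_
  simp only [Matrix.adjugate_apply]
  refine hd _ fun c d => ?_
  by_cases h : c = b
  · subst h
    simp
  · simpa [Matrix.updateRow_ne h] using hK c d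

theorem measurable_matrix_mul_apply {Ω l m n : Type*} [MeasurableSpace Ω] [Fintype m]
    {U : Ω → Matrix l m ℝ} {V : Ω → Matrix m n ℝ} (hU : ∀ i j, Measurable fun x => U x i j)
    (hV : ∀ i j, Measurable fun x => V x i j) (i : l) (j : n) :
    Measurable fun x => (U x * V x) i j := by
  simp only [Matrix.mul_apply]
  exact Finset.measurable_sum _ fun k _ => (hU i k).mul (hV k j)

theorem hasDerivAt_matrix_mul {l m n : Type*} [Fintype m] {U : ℝ → Matrix l m ℝ}
    {V : ℝ → Matrix m n ℝ} {U' : Matrix l m ℝ} {V' : Matrix m n ℝ} {x : ℝ}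
    (hU : ∀ i j, HasDerivAt (fun s => U s i j) (U' i j) x)
    (hV : ∀ i j, HasDerivAt (fun s => V s i j) (V' i j) x) (i : l) (j : n) :
    HasDerivAt (fun s => (U s * V s) i j) ((U' * V x + U x * V') i j) x := by
  simp only [Matrix.mul_apply, Matrix.add_apply, ← Finset.sum_add_distrib]
  exact HasDerivAt.fun_sum fun k _ => (hU i k).mul (hV k j)

/-! ### Matrix square roots and the resolvent of a Gram matrix -/

namespace Matrix

section Sqrt

open scoped MatrixOrder

variable {k : Type*} [Fintype k] [DecidableEq k] {S : Matrix k k ℝ}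

theorem PosSemidef.sqrt_mul_sqrt (hS : S.PosSemidef) : CFC.sqrt S * CFC.sqrt S = S :=
  CFC.sqrt_mul_sqrt_self S hS.nonneg

theorem transpose_sqrt (S : Matrix k k ℝ) : (CFC.sqrt S)ᵀ = CFC.sqrt S := by
  have h := (nonneg_iff_posSemidef.1 (CFC.sqrt_nonneg S)).isHermitian.eq
  rwa [conjTranspose_eq_transpose_of_trivial] at h

theorem PosSemidef.exists_eq_transpose_mul_self (hS : S.PosSemidef) :
    ∃ R : Matrix k k ℝ, S = Rᵀ * R :=
  ⟨CFC.sqrt S, by rw [transpose_sqrt, hS.sqrt_mul_sqrt]⟩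

end Sqrt

/-- Cauchy–Schwarz on the diagonal, after which the off-diagonal squares are added. -/
theorem sq_trace_le_card_mul_trace_transpose_mul_self {k : Type*} [Fintype k]
    (A : Matrix k k ℝ) :
    A.trace ^ 2 ≤ Fintype.card k * (Aᵀ * A).trace := by
  have h1 : A.trace ^ 2 ≤ Fintype.card k * ∑ i, A i i ^ 2 := by
    simpa [trace] using sq_sum_le_card_mul_sum_sq (s := Finset.univ) (f := fun i => A i i)
  refine h1.trans (mul_le_mul_of_nonneg_left ?_ (Nat.cast_nonneg _))
  simp only [trace, diag_apply, mul_apply, transpose_apply, ← sq]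
  exact Finset.sum_le_sum fun i _ =>
    Finset.single_le_sum (f := fun l => A l i ^ 2) (fun _ _ => sq_nonneg _) (Finset.mem_univ i)

variable {m k : Type*} [Fintype m] [Fintype k] [DecidableEq k]

/-- The resolvent `(ZᵀZ + ε)⁻¹` of the Gram matrix of `Z`. -/
noncomputable def gramResolvent (ε : ℝ) (Z : Matrix m k ℝ) : Matrix k k ℝ :=
  (Zᵀ * Z + ε • (1 : Matrix k k ℝ))⁻¹

variable {ε : ℝ}

theorem posDef_gram_add_smul_one (hε : 0 < ε) (Z : Matrix m k ℝ) :
    (Zᵀ * Z + ε • (1 : Matrix k k ℝ)).PosDef := by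
  have h1 := posSemidef_conjTranspose_mul_self Z
  rw [conjTranspose_eq_transpose_of_trivial] at h1
  exact PosDef.posSemidef_add h1 (PosDef.one.smul hε)

theorem posDef_gramResolvent (hε : 0 < ε) (Z : Matrix m k ℝ) : (gramResolvent ε Z).PosDef :=
  (posDef_gram_add_smul_one hε Z).inv

theorem gramResolvent_transpose (hε : 0 < ε) (Z : Matrix m k ℝ) :
    (gramResolvent ε Z)ᵀ = gramResolvent ε Z := by
  have := (posDef_gramResolvent hε Z).isHermitian.eq
  rwa [conjTranspose_eq_transpose_of_trivial] at this

theorem gram_mul_gramResolvent (hε : 0 < ε) (Z : Matrix m k ℝ) :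
    Zᵀ * Z * gramResolvent ε Z = 1 - ε • gramResolvent ε Z := by
  have h := Matrix.mul_nonsing_inv _
    ((Matrix.isUnit_iff_isUnit_det _).1 (posDef_gram_add_smul_one hε Z).isUnit)
  rw [Matrix.add_mul, Matrix.smul_mul, Matrix.one_mul] at h
  exact eq_sub_of_add_eq h

theorem gramResolvent_mul_gram (hε : 0 < ε) (Z : Matrix m k ℝ) :
    gramResolvent ε Z * (Zᵀ * Z) = 1 - ε • gramResolvent ε Z := by
  have h := Matrix.nonsing_inv_mul _
    ((Matrix.isUnit_iff_isUnit_det _).1 (posDef_gram_add_smul_one hε Z).isUnit)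
  rw [Matrix.mul_add, Matrix.mul_smul, Matrix.mul_one] at h
  exact eq_sub_of_add_eq h

/-- Compare the `(j, j)` entries in `G = (ZG)ᵀ(ZG) + ε GᵀG`. -/
theorem smul_sq_le_gramResolvent_diag (hε : 0 < ε) (Z : Matrix m k ℝ) (i j : k) :
    ε * gramResolvent ε Z i j ^ 2 ≤ gramResolvent ε Z j j := by
  set G := gramResolvent ε Z with hG
  have hGt : Gᵀ = G := gramResolvent_transpose hε Z
  have h : G = (Z * G)ᵀ * (Z * G) + ε • (Gᵀ * G) := by
    rw [transpose_mul, hGt]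
    calc G = G * (Zᵀ * Z * G) + ε • (G * G) := by
          rw [gram_mul_gramResolvent hε Z, ← hG, Matrix.mul_sub, Matrix.mul_one, Matrix.mul_smul,
            sub_add_cancel]
      _ = _ := by simp only [Matrix.mul_assoc]
  have h1 := congrFun (congrFun h j) j
  simp only [add_apply, smul_apply, mul_apply (M := (Z * G)ᵀ), mul_apply (M := Gᵀ),
    transpose_apply, smul_eq_mul, ← sq] at h1
  have h2 : 0 ≤ ∑ l, (Z * G) l j ^ 2 := Finset.sum_nonneg fun _ _ => sq_nonneg _
  have h3 : G i j ^ 2 ≤ ∑ l, G l j ^ 2 :=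
    Finset.single_le_sum (f := fun l => G l j ^ 2) (fun _ _ => sq_nonneg _) (Finset.mem_univ i)
  nlinarith

/-- The case `i = j` of the previous bound gives `ε Gⱼⱼ ≤ 1`, which is then fed back into the
general case. Uniformity in `Z` gives the resolvent all moments. -/
theorem abs_gramResolvent_le (hε : 0 < ε) (Z : Matrix m k ℝ) (i j : k) :
    |gramResolvent ε Z i j| ≤ ε⁻¹ := by
  have h1 := smul_sq_le_gramResolvent_diag hε Z i j
  have h2 := smul_sq_le_gramResolvent_diag hε Z j j
  have h3 : 0 < gramResolvent ε Z j j := (posDef_gramResolvent hε Z).diag_pos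
  have h4 : ε * gramResolvent ε Z j j ≤ 1 := by
    by_contra! h
    nlinarith
  refine abs_le_of_sq_le_sq ?_ (inv_nonneg.2 hε.le)
  have h5 : ε ^ 2 * gramResolvent ε Z i j ^ 2 ≤ 1 := by nlinarith
  rw [inv_pow, ← one_div, le_div_iff₀ (by positivity)]
  linarith

theorem trace_gramResolvent_nonneg (hε : 0 < ε) (Z : Matrix m k ℝ) :
    0 ≤ (gramResolvent ε Z).trace :=
  (posDef_gramResolvent hε Z).posSemidef.trace_nonneg

theorem trace_gramResolvent_sq_nonneg (hε : 0 < ε) (Z : Matrix m k ℝ) :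
    0 ≤ (gramResolvent ε Z * gramResolvent ε Z).trace := by
  have h := (posSemidef_conjTranspose_mul_self (gramResolvent ε Z)).trace_nonneg
  rwa [conjTranspose_eq_transpose_of_trivial, gramResolvent_transpose hε] at h

theorem trace_gramResolvent_cube_nonneg (hε : 0 < ε) (Z : Matrix m k ℝ) :
    0 ≤ (gramResolvent ε Z * gramResolvent ε Z * gramResolvent ε Z).trace := by
  have h := ((posDef_gramResolvent hε Z).posSemidef.conjTranspose_mul_mul_same
    (gramResolvent ε Z)).trace_nonneg
  rwa [conjTranspose_eq_transpose_of_trivial, gramResolvent_transpose hε] at h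

theorem sq_trace_gramResolvent_le (hε : 0 < ε) (Z : Matrix m k ℝ) :
    (gramResolvent ε Z).trace ^ 2 ≤
      Fintype.card k * (gramResolvent ε Z * gramResolvent ε Z).trace := by
  have h := sq_trace_le_card_mul_trace_transpose_mul_self (gramResolvent ε Z)
  rwa [gramResolvent_transpose hε] at h

/-- If `ZᵀZ` is singular, the trace of the resolvent blows up at rate `1/ε`. -/
theorem inv_le_trace_gramResolvent (hε : 0 < ε) (Z : Matrix m k ℝ) (hZ : ¬ IsUnit (Zᵀ * Z)) :
    ε⁻¹ ≤ (gramResolvent ε Z).trace := by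
  rw [isUnit_iff_isUnit_det, isUnit_iff_ne_zero, not_not] at hZ
  obtain ⟨v, hv0, hv⟩ := Matrix.exists_mulVec_eq_zero_iff.2 hZ
  set G := gramResolvent ε Z with hG
  -- A kernel vector of `ZᵀZ` is an eigenvector of the resolvent with eigenvalue `1/ε`.
  have hGv : G *ᵥ v = ε⁻¹ • v := by
    have h := congrArg (fun A => A *ᵥ v) (gramResolvent_mul_gram hε Z)
    simp only [← mulVec_mulVec, hv, mulVec_zero, sub_mulVec, one_mulVec, smul_mulVec] at h
    have h' : v = ε • (G *ᵥ v) := (sub_eq_zero.1 h.symm)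
    rw [eq_inv_smul_iff₀ hε.ne']
    exact h'.symm
  obtain ⟨R, hR⟩ := (posDef_gramResolvent hε Z).posSemidef.exists_eq_transpose_mul_self
  rw [← hG] at hR
  have hvv : 0 < v ⬝ᵥ v := by
    have := dotProduct_star_self_pos_iff.2 hv0
    simpa using this
  have h1 : v ⬝ᵥ (G *ᵥ v) = ε⁻¹ * (v ⬝ᵥ v) := by rw [hGv, dotProduct_smul, smul_eq_mul]
  have h2 : v ⬝ᵥ (G *ᵥ v) = ∑ i, (∑ j, R i j * v j) ^ 2 := by
    rw [hR, ← mulVec_mulVec, dotProduct_mulVec, vecMul_transpose]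
    simp [dotProduct, mulVec, sq]
  have h3 : G.trace = ∑ i, ∑ j, R i j ^ 2 := by
    rw [hR, Finset.sum_comm]
    simp [trace, mul_apply, sq]
  have h4 : v ⬝ᵥ v = ∑ j, v j ^ 2 := by simp [dotProduct, sq]
  -- With `G = RᵀR`, this is Cauchy–Schwarz on each row of `R`.
  have h5 : v ⬝ᵥ (G *ᵥ v) ≤ G.trace * (v ⬝ᵥ v) := by
    rw [h2, h3, h4, Finset.sum_mul]
    exact Finset.sum_le_sum fun i _ => Finset.sum_mul_sq_le_sq_mul_sq _ _ _
  rw [h1] at h5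
  exact le_of_mul_le_mul_right h5 hvv

theorem hasDerivAt_gramResolvent (hε : 0 < ε) {Z : ℝ → Matrix m k ℝ} {E : Matrix m k ℝ} {x : ℝ}
    (hZ : ∀ i j, HasDerivAt (fun s => Z s i j) (E i j) x) (a b : k) :
    HasDerivAt (fun s => gramResolvent ε (Z s) a b)
      (-(gramResolvent ε (Z x) * (Eᵀ * Z x + (Z x)ᵀ * E) * gramResolvent ε (Z x)) a b) x := by
  refine hasDerivAt_matrix_inv (K := fun s => (Z s)ᵀ * Z s + ε • (1 : Matrix k k ℝ))
    (fun a b => ?_) (posDef_gram_add_smul_one hε (Z x)).isUnit a b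
  simp only [add_apply (A := _ᵀ * _) (B := ε • _)]
  exact (hasDerivAt_matrix_mul (U := fun s => (Z s)ᵀ) (U' := Eᵀ) (fun i j => hZ j i) hZ a b).add_const _

theorem measurable_gramResolvent_apply {Ω : Type*} [MeasurableSpace Ω] {Z : Ω → Matrix m k ℝ}
    (hZ : ∀ i j, Measurable fun w => Z w i j) (ε : ℝ) (a b : k) :
    Measurable fun w => gramResolvent ε (Z w) a b := by
  refine measurable_matrix_inv_apply (fun a b => ?_) a b
  exact (measurable_matrix_mul_apply (U := fun w => (Z w)ᵀ) (fun i j => hZ j i) hZ a b).add_const _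

/-- Continuity of `s ↦ (ZᵀZ + s)⁻¹` at `0`, read off from its differentiability there. -/
theorem tendsto_gramResolvent_trace {Z : Matrix m k ℝ} (hZ : IsUnit (Zᵀ * Z)) {ι : Type*}
    {l : Filter ι} {e : ι → ℝ} (he : Filter.Tendsto e l (nhds 0)) :
    Filter.Tendsto (fun i => (gramResolvent (e i) Z).trace) l (nhds ((Zᵀ * Z)⁻¹.trace)) := by
  have h : ∀ a, Filter.Tendsto (fun s : ℝ => gramResolvent s Z a a) (nhds 0)
      (nhds ((Zᵀ * Z)⁻¹ a a)) := by
    intro a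
    have := hasDerivAt_matrix_inv (K := fun s : ℝ => Zᵀ * Z + s • (1 : Matrix k k ℝ)) (K' := 1)
      (x := 0) (fun a b => by
        simpa using ((hasDerivAt_id (0 : ℝ)).mul_const ((1 : Matrix k k ℝ) a b)).const_add
          ((Zᵀ * Z) a b)) (by simpa using hZ) a a
    simpa [gramResolvent] using this.continuousAt.tendsto
  exact tendsto_finsetSum _ fun a _ => (h a).comp he

end Matrix

/-! ### Stein's lemma for Gaussian matrices and the divergences it produces -/

namespace Matrix

theorem mul_single_one_mul_apply {l m n o : Type*} [Fintype m] [Fintype n] [DecidableEq m]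
    [DecidableEq n] (A : Matrix l m ℝ) (i : m) (j : n) (C : Matrix n o ℝ) (a : l) (b : o) :
    (A * single i j (1 : ℝ) * C) a b = A a i * C j b := by
  simp [mul_apply, single_apply, ite_and]

variable {m k : Type*} [Fintype m] [DecidableEq m] [Fintype k] [DecidableEq k]

/-- This and the transposed version below turn a divergence into traces: a word `A E C` in the
direction `E` gives a product of traces, a word `A Eᵀ C` a single trace. -/
theorem sum_mul_single_mul_apply (A : Matrix m m ℝ) (C : Matrix k k ℝ) :
    ∑ i, ∑ j, (A * (single i j (1 : ℝ) : Matrix m k ℝ) * C) i j = A.trace * C.trace := by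
  simp only [mul_single_one_mul_apply, trace, diag_apply, Finset.sum_mul_sum]

theorem sum_mul_transpose_single_mul_apply (A C : Matrix m k ℝ) :
    ∑ i, ∑ j, (A * (single i j (1 : ℝ) : Matrix m k ℝ)ᵀ * C) i j = (Aᵀ * C).trace := by
  simp only [transpose_single, mul_single_one_mul_apply]
  simp only [trace, diag_apply, mul_apply, transpose_apply]
  exact Finset.sum_comm

/-- The matrix with entries `w (i, j)`. -/
def ofPairs (w : m × k → ℝ) : Matrix m k ℝ := of fun i j => w (i, j)

omit [Fintype m] [Fintype k] in
theorem ofPairs_add_single (w : m × k → ℝ) (i : m) (j : k) (s : ℝ) :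
    ofPairs (w + s • Pi.single (i, j) (1 : ℝ)) = ofPairs w + s • single i j (1 : ℝ) := by
  ext a b
  by_cases h : (a, b) = (i, j)
  · obtain ⟨rfl, rfl⟩ := Prod.mk.inj h
    simp [ofPairs]
  · have h' : ¬ (i = a ∧ j = b) := fun h2 => h (by rw [h2.1, h2.2])
    simp [ofPairs, h, h']

/-- **Stein's lemma** for a Gaussian matrix with independent standard entries. -/
theorem integral_trace_transpose_mul_pi_gaussianReal {F : Matrix m k ℝ → Matrix m k ℝ}
    {F' : m → k → Matrix m k ℝ → ℝ}
    (hF : ∀ N i j, HasDerivAt (fun s : ℝ => F (N + s • single i j (1 : ℝ)) i j) (F' i j N) 0)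
    (hm : ∀ i j, HasAllMoments (fun w => F (ofPairs w) i j) (Measure.pi fun _ => gaussianReal 0 1))
    (hm' : ∀ i j, HasAllMoments (fun w => F' i j (ofPairs w))
      (Measure.pi fun _ => gaussianReal 0 1)) :
    ∫ w, ((ofPairs w)ᵀ * F (ofPairs w)).trace ∂(Measure.pi fun _ : m × k => gaussianReal 0 1) =
      ∫ w, ∑ i, ∑ j, F' i j (ofPairs w) ∂(Measure.pi fun _ : m × k => gaussianReal 0 1) := by
  have h1 : ∀ w : m × k → ℝ, ((ofPairs w)ᵀ * F (ofPairs w)).trace =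
      ∑ i, ∑ j, w (i, j) * F (ofPairs w) i j := by
    intro w
    simp only [trace, diag_apply, mul_apply, transpose_apply]
    exact Finset.sum_comm
  have h2 : ∀ i j, HasAllMoments (fun w : m × k → ℝ => w (i, j) * F (ofPairs w) i j)
      (Measure.pi fun _ => gaussianReal 0 1) := fun i j =>
    (HasAllMoments.eval_pi_gaussianReal (i, j)).mul (hm i j)
  simp only [h1]
  rw [integral_finsetSum _ fun i _ => (HasAllMoments.sum _ fun j _ => h2 i j).integrable,
    integral_finsetSum _ fun i _ => (HasAllMoments.sum _ fun j _ => hm' i j).integrable]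
  refine Finset.sum_congr rfl fun i _ => ?_
  rw [integral_finsetSum _ fun j _ => (h2 i j).integrable,
    integral_finsetSum _ fun j _ => (hm' i j).integrable]
  refine Finset.sum_congr rfl fun j _ => ?_
  refine integral_eval_mul_pi_gaussianReal (i, j) (fun w => ?_) (hm i j).integrable
    (hm' i j).integrable (h2 i j).integrable
  simp only [ofPairs_add_single]
  exact hF _ i j

section Projection

variable {ε : ℝ} {M : Matrix m k ℝ} {P : Matrix m m ℝ}

omit [DecidableEq m] [Fintype k] [DecidableEq k] in
theorem hasDerivAt_proj_add_apply (N E : Matrix m k ℝ) (a : m) (b : k) :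
    HasDerivAt (fun s : ℝ => (M + P * (N + s • E)) a b) ((P * E) a b) 0 := by
  have : ∀ s : ℝ, (M + P * (N + s • E)) a b = (M + P * N) a b + s * (P * E) a b := by
    intro s
    rw [Matrix.mul_add, Matrix.mul_smul, ← add_assoc]
    simp
  simp only [this]
  simpa using ((hasDerivAt_id (0 : ℝ)).mul_const ((P * E) a b)).const_add ((M + P * N) a b)

omit [DecidableEq m] [Fintype k] [DecidableEq k] in
theorem proj_mul_add (hPP : P * P = P) (hPM : P * M = M) (N : Matrix m k ℝ) :
    P * (M + P * N) = M + P * N := by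
  rw [Matrix.mul_add, hPM, ← Matrix.mul_assoc, hPP]

omit [DecidableEq m] in
/-- Directional derivatives of the resolvent of the Gram matrix of `Z = M + P N`, where `P` is an
orthogonal projection and `P M = M`. -/
theorem hasDerivAt_gramResolvent_proj (hε : 0 < ε) (hPt : Pᵀ = P) (hPP : P * P = P)
    (hPM : P * M = M) (N E : Matrix m k ℝ) (a b : k) :
    HasDerivAt (fun s : ℝ => gramResolvent ε (M + P * (N + s • E)) a b)
      (-(gramResolvent ε (M + P * N) * (Eᵀ * (M + P * N) + (M + P * N)ᵀ * E) *
        gramResolvent ε (M + P * N)) a b) 0 := by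
  have h := hasDerivAt_gramResolvent hε (hasDerivAt_proj_add_apply (M := M) (P := P) N E) a b
  simp only [zero_smul, add_zero] at h
  have hPZ := proj_mul_add hPP hPM N
  -- Since `P` is symmetric and fixes `Z`, it is absorbed next to `Z`.
  have e1 : (P * E)ᵀ * (M + P * N) = Eᵀ * (M + P * N) := by
    rw [transpose_mul, hPt, Matrix.mul_assoc, hPZ]
  have e2 : (M + P * N)ᵀ * (P * E) = (M + P * N)ᵀ * E := by
    conv_rhs => rw [← hPZ, transpose_mul, hPt]
    rw [Matrix.mul_assoc]
  rwa [e1, e2] at h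

/-- The two halves of the derivative of `G` are transposes of each other, so their traces agree;
hence the factor `-2`. -/
theorem hasDerivAt_trace_gramResolvent (hε : 0 < ε) (hPt : Pᵀ = P) (hPP : P * P = P)
    (hPM : P * M = M) (N : Matrix m k ℝ) (i : m) (j : k) :
    HasDerivAt
      (fun s : ℝ => (gramResolvent ε (M + P * (N + s • (single i j (1 : ℝ) : Matrix m k ℝ)))).trace)
      (-2 * ((M + P * N) * (gramResolvent ε (M + P * N) * gramResolvent ε (M + P * N))) i j) 0 := by
  refine (HasDerivAt.fun_sum (u := Finset.univ) fun a (_ : a ∈ Finset.univ) =>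
    hasDerivAt_gramResolvent_proj hε hPt hPP hPM N (single i j (1 : ℝ)) a a).congr_deriv ?_
  set Z := M + P * N
  set G := gramResolvent ε Z
  have hGt : Gᵀ = G := gramResolvent_transpose hε Z
  change (-(G * ((single i j (1 : ℝ) : Matrix m k ℝ)ᵀ * Z + Zᵀ * single i j (1 : ℝ)) * G)).trace = _
  have h1 : (G * ((single i j (1 : ℝ) : Matrix m k ℝ)ᵀ * Z) * G).trace = (Z * (G * G)) i j := by
    rw [Matrix.mul_assoc, trace_mul_comm, transpose_single, Matrix.mul_assoc, Matrix.mul_assoc,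
      trace_single_mul, one_smul]
  have h2 : (G * (Zᵀ * single i j (1 : ℝ)) * G).trace = (Z * (G * G)) i j := by
    rw [← h1, ← trace_transpose]
    simp only [transpose_mul, transpose_transpose, hGt, Matrix.mul_assoc]
  rw [Matrix.mul_add, Matrix.add_mul, trace_neg, trace_add, h1, h2]
  ring

/-- The divergence of `N ↦ Z (ZᵀZ + ε)⁻²`, where `Z = M + P N`. -/
theorem sum_deriv_mul_gramResolvent_sq (hε : 0 < ε) (Z : Matrix m k ℝ) :
    ∑ i, ∑ j, (P * (single i j (1 : ℝ) : Matrix m k ℝ) * (gramResolvent ε Z * gramResolvent ε Z) +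
      Z * (-(gramResolvent ε Z * ((single i j (1 : ℝ) : Matrix m k ℝ)ᵀ * Z + Zᵀ * single i j (1 : ℝ)) *
          gramResolvent ε Z) * gramResolvent ε Z +
        gramResolvent ε Z * -(gramResolvent ε Z *
          ((single i j (1 : ℝ) : Matrix m k ℝ)ᵀ * Z + Zᵀ * single i j (1 : ℝ)) * gramResolvent ε Z))) i j =
      (P.trace - Fintype.card k - 2) * (gramResolvent ε Z * gramResolvent ε Z).trace -
        (gramResolvent ε Z).trace ^ 2 +
        2 * ε * (gramResolvent ε Z * gramResolvent ε Z * gramResolvent ε Z).trace +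
        2 * ε * (gramResolvent ε Z).trace * (gramResolvent ε Z * gramResolvent ε Z).trace := by
  have hWG := gram_mul_gramResolvent hε Z
  set G := gramResolvent ε Z
  have hGt : Gᵀ = G := gramResolvent_transpose hε Z
  -- The product rule leaves five words linear in `E`. Their traces are reduced by `ZᵀZ G = 1 - εG`,
  -- the source of all terms in `ε`.
  have hexp : ∀ E : Matrix m k ℝ,
      P * E * (G * G) + Z * (-(G * (Eᵀ * Z + Zᵀ * E) * G) * G + G * -(G * (Eᵀ * Z + Zᵀ * E) * G)) =
      P * E * (G * G) - (Z * G) * Eᵀ * (Z * (G * G)) - (Z * G * Zᵀ) * E * (G * G)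
        - (Z * (G * G)) * Eᵀ * (Z * G) - (Z * (G * G) * Zᵀ) * E * G := by
    intro E
    simp only [Matrix.mul_add, Matrix.add_mul, Matrix.mul_neg, Matrix.neg_mul, Matrix.mul_assoc]
    abel
  have t1 : ((Z * G)ᵀ * (Z * (G * G))).trace = (G * G).trace - ε * (G * G * G).trace := by
    have : (Z * G)ᵀ * (Z * (G * G)) = G * (Zᵀ * Z * G) * G := by
      rw [transpose_mul, hGt]
      simp only [Matrix.mul_assoc]
    rw [this, hWG, Matrix.mul_sub, Matrix.sub_mul, Matrix.mul_one, Matrix.mul_smul,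
      Matrix.smul_mul, trace_sub, trace_smul, smul_eq_mul]
  have t2 : ((Z * (G * G))ᵀ * (Z * G)).trace = (G * G).trace - ε * (G * G * G).trace := by
    rw [← t1, ← trace_transpose, transpose_mul, transpose_transpose]
  have t3 : (Z * G * Zᵀ).trace = Fintype.card k - ε * G.trace := by
    rw [trace_mul_comm, ← Matrix.mul_assoc, hWG, trace_sub, trace_smul, trace_one, smul_eq_mul]
  have t4 : (Z * (G * G) * Zᵀ).trace = G.trace - ε * (G * G).trace := by
    rw [trace_mul_comm, ← Matrix.mul_assoc, ← Matrix.mul_assoc, hWG, Matrix.sub_mul,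
      Matrix.one_mul, Matrix.smul_mul, trace_sub, trace_smul, smul_eq_mul]
  simp only [hexp, sub_apply, Finset.sum_sub_distrib, sum_mul_single_mul_apply,
    sum_mul_transpose_single_mul_apply, t1, t2, t3, t4]
  ring

end Projection

end Matrix

/-! ### The risk inequality for the regularized correction -/

namespace Matrix

variable {m k : Type*} [Fintype m] [DecidableEq m] [Fintype k] [DecidableEq k]
  {ε : ℝ} {M : Matrix m k ℝ} {P : Matrix m m ℝ}

omit [DecidableEq m] [DecidableEq k] in
theorem hasAllMoments_ofPairs (i : m) (j : k) :
    HasAllMoments (fun w : m × k → ℝ => ofPairs w i j) (Measure.pi fun _ => gaussianReal 0 1) :=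
  HasAllMoments.eval_pi_gaussianReal (i, j)

omit [DecidableEq m] [DecidableEq k] in
theorem hasAllMoments_const_mul_ofPairs {l : Type*} (A : Matrix l m ℝ) (i : l) (j : k) :
    HasAllMoments (fun w : m × k → ℝ => (A * ofPairs w) i j)
      (Measure.pi fun _ => gaussianReal 0 1) :=
  HasAllMoments.matrix_mul (U := fun _ => A) (fun _ _ => HasAllMoments.const _)
    hasAllMoments_ofPairs i j

omit [DecidableEq m] [Fintype k] [DecidableEq k] in
theorem measurable_proj_ofPairs (i : m) (j : k) :
    Measurable fun w : m × k → ℝ => (M + P * ofPairs w) i j :=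
  (measurable_matrix_mul_apply (U := fun _ => P) (V := fun w : m × k → ℝ => ofPairs w)
    (fun _ _ => measurable_const) (fun i j => measurable_pi_apply (i, j)) i j).const_add _

omit [DecidableEq m] [DecidableEq k] in
theorem hasAllMoments_proj_ofPairs (i : m) (j : k) :
    HasAllMoments (fun w : m × k → ℝ => (M + P * ofPairs w) i j)
      (Measure.pi fun _ => gaussianReal 0 1) :=
  (HasAllMoments.const (M i j)).add (hasAllMoments_const_mul_ofPairs P i j)

omit [DecidableEq m] in
theorem hasAllMoments_gramResolvent (hε : 0 < ε) (i j : k) :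
    HasAllMoments (fun w : m × k → ℝ => gramResolvent ε (M + P * ofPairs w) i j)
      (Measure.pi fun _ => gaussianReal 0 1) :=
  HasAllMoments.of_bound (measurable_gramResolvent_apply measurable_proj_ofPairs ε i j) ε⁻¹
    fun _ => abs_gramResolvent_le hε _ i j

/-- Two applications of Stein's lemma, the first to `tr(G) (1 - 2P) N` and the second to `Z G²`, the
field left over by differentiating `tr G` in the first. -/
theorem integral_trace_gramResolvent_mul (hε : 0 < ε) (hPt : Pᵀ = P) (hPP : P * P = P)
    (hPM : P * M = M) :
    ∫ w, (gramResolvent ε (M + P * ofPairs w)).trace *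
        (((ofPairs w)ᵀ * ((1 - (2 : ℝ) • P) * ofPairs w)).trace +
          (2 * P.trace - Fintype.card m) * Fintype.card k)
        ∂(Measure.pi fun _ : m × k => gaussianReal 0 1) =
      2 * ∫ w, ((P.trace - Fintype.card k - 2) *
          (gramResolvent ε (M + P * ofPairs w) * gramResolvent ε (M + P * ofPairs w)).trace -
        (gramResolvent ε (M + P * ofPairs w)).trace ^ 2 +
        2 * ε * (gramResolvent ε (M + P * ofPairs w) * gramResolvent ε (M + P * ofPairs w) *
          gramResolvent ε (M + P * ofPairs w)).trace +
        2 * ε * (gramResolvent ε (M + P * ofPairs w)).trace *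
          (gramResolvent ε (M + P * ofPairs w) * gramResolvent ε (M + P * ofPairs w)).trace)
        ∂(Measure.pi fun _ : m × k => gaussianReal 0 1) := by
  set A : Matrix m m ℝ := 1 - (2 : ℝ) • P with hA
  set μ : Measure (m × k → ℝ) := Measure.pi fun _ => gaussianReal 0 1 with hμ
  set Z : Matrix m k ℝ → Matrix m k ℝ := fun N => M + P * N with hZ
  set G : Matrix m k ℝ → Matrix k k ℝ := fun N => gramResolvent ε (Z N) with hG
  set κ : ℝ := (2 * P.trace - Fintype.card m) * Fintype.card k with hκ
  have mG : ∀ i j, HasAllMoments (fun w => G (ofPairs w) i j) μ := hasAllMoments_gramResolvent hε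
  have mZ : ∀ i j, HasAllMoments (fun w => Z (ofPairs w) i j) μ := hasAllMoments_proj_ofPairs
  have mA : ∀ i j, HasAllMoments (fun w => (A * ofPairs w) i j) μ :=
    hasAllMoments_const_mul_ofPairs A
  have mt : HasAllMoments (fun w => (G (ofPairs w)).trace) μ := HasAllMoments.trace mG
  have mGG := HasAllMoments.matrix_mul mG mG
  have mZGG := HasAllMoments.matrix_mul mZ mGG
  have mNF : HasAllMoments (fun w => ((ofPairs w)ᵀ *
      (Z (ofPairs w) * (G (ofPairs w) * G (ofPairs w)))).trace) μ :=
    HasAllMoments.trace (HasAllMoments.matrix_mul (U := fun w : m × k → ℝ => (ofPairs w)ᵀ)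
      (fun i j => hasAllMoments_ofPairs j i) mZGG)
  have mNA : HasAllMoments (fun w => ((ofPairs w)ᵀ * (A * ofPairs w)).trace) μ :=
    HasAllMoments.trace (HasAllMoments.matrix_mul (U := fun w : m × k → ℝ => (ofPairs w)ᵀ)
      (fun i j => hasAllMoments_ofPairs j i) mA)
  have stein1 := integral_trace_transpose_mul_pi_gaussianReal
    (F := fun N => (G N).trace • (A * N))
    (F' := fun i j N => -2 * (Z N * (G N * G N)) i j * (A * N) i j + (G N).trace * A i i)
    (fun N i j => by
      have h1 := hasDerivAt_trace_gramResolvent hε hPt hPP hPM N i j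
      have h2 := hasDerivAt_proj_add_apply (M := 0) (P := A) N (single i j (1 : ℝ)) i j
      simp only [zero_add] at h2
      refine (h1.mul h2).congr_deriv ?_
      have h3 : (A * single i j (1 : ℝ)) i j = A i i := by
        simp
      rw [h3]
      simp only [zero_smul, add_zero]
      rfl)
    (fun i j => mt.mul (mA i j))
    (fun i j => (((HasAllMoments.const (-2)).mul (mZGG i j)).mul (mA i j)).add
      (mt.mul (HasAllMoments.const _)))
  have stein2 := integral_trace_transpose_mul_pi_gaussianReal
    (F := fun N => Z N * (G N * G N))
    (F' := fun i j N => (P * single i j (1 : ℝ) * (G N * G N) +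
      Z N * (-(G N * ((single i j (1 : ℝ))ᵀ * Z N + (Z N)ᵀ * single i j (1 : ℝ)) * G N) * G N +
        G N * -(G N * ((single i j (1 : ℝ))ᵀ * Z N + (Z N)ᵀ * single i j (1 : ℝ)) * G N))) i j)
    (fun N i j => by
      have h1 := hasDerivAt_proj_add_apply (M := M) (P := P) N (single i j (1 : ℝ))
      have h2 := hasDerivAt_gramResolvent_proj hε hPt hPP hPM N (single i j (1 : ℝ))
      have h3 := hasDerivAt_matrix_mul
        (U := fun s : ℝ => G (N + s • single i j (1 : ℝ)))
        (V := fun s : ℝ => G (N + s • single i j (1 : ℝ))) h2 h2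
      have h4 := hasDerivAt_matrix_mul (U := fun s : ℝ => Z (N + s • single i j (1 : ℝ))) h1 h3 i j
      refine h4.congr_deriv ?_
      simp only [zero_smul, add_zero]
      rfl)
    mZGG
    (fun i j => by
      have mE : ∀ a b, HasAllMoments (fun _ : m × k → ℝ => (single i j (1 : ℝ) : Matrix m k ℝ) a b) μ :=
        fun a b => HasAllMoments.const _
      have mEZ := HasAllMoments.matrix_mul
        (U := fun _ : m × k → ℝ => (single i j (1 : ℝ) : Matrix m k ℝ)ᵀ) (fun a b => mE b a) mZ
      have mZE := HasAllMoments.matrix_mul (U := fun w => (Z (ofPairs w))ᵀ) (fun a b => mZ b a) mE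
      have mS := fun a b => (mEZ a b).add (mZE a b)
      have mD := fun a b => (HasAllMoments.matrix_mul (HasAllMoments.matrix_mul mG
        (V := fun w => (single i j (1 : ℝ))ᵀ * Z (ofPairs w) +
          (Z (ofPairs w))ᵀ * single i j (1 : ℝ)) mS) mG a b).neg
      have mD1 := HasAllMoments.matrix_mul (U := fun w => -(G (ofPairs w) *
        ((single i j (1 : ℝ))ᵀ * Z (ofPairs w) + (Z (ofPairs w))ᵀ * single i j (1 : ℝ)) *
        G (ofPairs w))) mD mG
      have mD2 := HasAllMoments.matrix_mul (V := fun w => -(G (ofPairs w) *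
        ((single i j (1 : ℝ))ᵀ * Z (ofPairs w) + (Z (ofPairs w))ᵀ * single i j (1 : ℝ)) *
        G (ofPairs w))) mG mD
      have mR := HasAllMoments.matrix_mul (V := fun w => -(G (ofPairs w) *
          ((single i j (1 : ℝ))ᵀ * Z (ofPairs w) + (Z (ofPairs w))ᵀ * single i j (1 : ℝ)) *
          G (ofPairs w)) * G (ofPairs w) + G (ofPairs w) * -(G (ofPairs w) *
          ((single i j (1 : ℝ))ᵀ * Z (ofPairs w) + (Z (ofPairs w))ᵀ * single i j (1 : ℝ)) *
          G (ofPairs w))) mZ (fun a b => (mD1 a b).add (mD2 a b)) i j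
      exact (HasAllMoments.matrix_mul
        (U := fun _ => P * single i j (1 : ℝ)) (fun _ _ => HasAllMoments.const _) mGG i j).add mR)
  simp only [hG, sum_deriv_mul_gramResolvent_sq hε] at stein2
  rw [← stein2]
  have e1 : ∀ w : m × k → ℝ, (G (ofPairs w)).trace *
      (((ofPairs w)ᵀ * (A * ofPairs w)).trace + κ) =
      ((ofPairs w)ᵀ * ((G (ofPairs w)).trace • (A * ofPairs w))).trace +
        (G (ofPairs w)).trace * κ := by
    intro w
    rw [Matrix.mul_smul, trace_smul, smul_eq_mul, mul_add]
  have e2 : ∀ N : Matrix m k ℝ,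
      ∑ i, ∑ j, (-2 * (Z N * (G N * G N)) i j * (A * N) i j + (G N).trace * A i i) =
      2 * (Nᵀ * (Z N * (G N * G N))).trace - (G N).trace * κ := by
    intro N
    -- `A = 1 - 2P` is the reflection that is `-1` on the range of `P`, which contains the columns
    -- of `Z`.
    have hAF : A * (Z N * (G N * G N)) = -(Z N * (G N * G N)) := by
      rw [hA, Matrix.sub_mul, Matrix.one_mul, Matrix.smul_mul, ← Matrix.mul_assoc P,
        proj_mul_add hPP hPM N, two_smul]
      abel
    have hAt : Aᵀ = A := by
      rw [hA, transpose_sub, transpose_one, transpose_smul, hPt]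
    have h1 : ∑ i, ∑ j, (Z N * (G N * G N)) i j * (A * N) i j =
        -(Nᵀ * (Z N * (G N * G N))).trace := by
      have : ∑ i, ∑ j, (Z N * (G N * G N)) i j * (A * N) i j =
          ((A * N)ᵀ * (Z N * (G N * G N))).trace := by
        rw [Finset.sum_comm]
        simp only [trace, diag_apply, mul_apply (M := (A * N)ᵀ), transpose_apply]
        exact Finset.sum_congr rfl fun j _ => Finset.sum_congr rfl fun i _ => mul_comm _ _
      rw [this, transpose_mul, hAt, Matrix.mul_assoc, hAF, Matrix.mul_neg, trace_neg]
    -- The divergence of `A N` is `-κ`; this is why `κ` drops out of the final identity.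
    have h2 : ∑ i : m, ∑ _j : k, (G N).trace * A i i = -((G N).trace * κ) := by
      have : A.trace = Fintype.card m - 2 * P.trace := by
        rw [hA, trace_sub, trace_one, trace_smul, smul_eq_mul]
      simp only [Finset.sum_const, Finset.card_univ, nsmul_eq_mul, ← Finset.mul_sum]
      change (Fintype.card k : ℝ) * ((G N).trace * A.trace) = _
      rw [this, hκ]
      ring
    simp only [Finset.sum_add_distrib, h2]
    simp only [mul_assoc, ← Finset.mul_sum, h1]
    ring
  simp only [e2] at stein1
  change ∫ w, (G (ofPairs w)).trace * (((ofPairs w)ᵀ * (A * ofPairs w)).trace + κ) ∂μ =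
    2 * ∫ w, ((ofPairs w)ᵀ * (Z (ofPairs w) * (G (ofPairs w) * G (ofPairs w)))).trace ∂μ
  simp only [e1]
  have i1 : Integrable (fun w => ((ofPairs w)ᵀ *
      ((G (ofPairs w)).trace • (A * ofPairs w))).trace) μ := by
    simp only [Matrix.mul_smul, trace_smul, smul_eq_mul]
    exact (mt.mul mNA).integrable
  have i2 : Integrable (fun w => (G (ofPairs w)).trace * κ) μ :=
    (mt.mul (HasAllMoments.const κ)).integrable
  rw [integral_add i1 i2, stein1, integral_sub (mNF.integrable.const_mul 2) i2,
    integral_const_mul]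
  ring

/-- The risk improvement for the regularized correction. -/
theorem le_integral_trace_gramResolvent_mul (hε : 0 < ε) (hPt : Pᵀ = P) (hPP : P * P = P)
    (hPM : P * M = M) (hk : 0 < Fintype.card k) (hP : (Fintype.card k : ℝ) + 2 ≤ P.trace) :
    2 * (P.trace - 2 * Fintype.card k - 2) / Fintype.card k *
      ∫ w, (gramResolvent ε (M + P * ofPairs w)).trace ^ 2
        ∂(Measure.pi fun _ : m × k => gaussianReal 0 1) ≤
    ∫ w, (gramResolvent ε (M + P * ofPairs w)).trace *
        (((ofPairs w)ᵀ * ((1 - (2 : ℝ) • P) * ofPairs w)).trace +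
          (2 * P.trace - Fintype.card m) * Fintype.card k)
        ∂(Measure.pi fun _ : m × k => gaussianReal 0 1) := by
  rw [integral_trace_gramResolvent_mul hε hPt hPP hPM, mul_div_assoc, mul_assoc,
    ← integral_const_mul]
  have mG := hasAllMoments_gramResolvent (M := M) (P := P) hε
  have mt := HasAllMoments.trace mG
  have mGG := HasAllMoments.matrix_mul mG mG
  have mt2 := HasAllMoments.trace mGG
  have mt3 := HasAllMoments.trace (HasAllMoments.matrix_mul mGG mG)
  have mtt : HasAllMoments (fun w : m × k → ℝ => (gramResolvent ε (M + P * ofPairs w)).trace ^ 2)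
      (Measure.pi fun _ => gaussianReal 0 1) := by
    simp only [sq]
    exact mt.mul mt
  refine mul_le_mul_of_nonneg_left (integral_mono (mtt.integrable.const_mul _) ?_ fun w => ?_)
    zero_le_two
  · exact (((((HasAllMoments.const _).mul mt2).sub mtt).add ((HasAllMoments.const _).mul mt3)).add
      (((HasAllMoments.const _).mul mt).mul mt2)).integrable
  · simp only
    have h1 := trace_gramResolvent_nonneg hε (M + P * ofPairs w)
    have h2 := trace_gramResolvent_sq_nonneg hε (M + P * ofPairs w)
    have h3 := trace_gramResolvent_cube_nonneg hε (M + P * ofPairs w)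
    have h4 := sq_trace_gramResolvent_le hε (M + P * ofPairs w)
    generalize (gramResolvent ε (M + P * ofPairs w)).trace = t1 at *
    generalize (gramResolvent ε (M + P * ofPairs w) * gramResolvent ε (M + P * ofPairs w)).trace
      = t2 at *
    generalize (gramResolvent ε (M + P * ofPairs w) * gramResolvent ε (M + P * ofPairs w) *
      gramResolvent ε (M + P * ofPairs w)).trace = t3 at *
    have hk' : (0 : ℝ) < Fintype.card k := by exact_mod_cast hk
    have h5 : t1 ^ 2 / Fintype.card k ≤ t2 := by
      rw [div_le_iff₀ hk']
      linarith
    have h6 := mul_le_mul_of_nonneg_left h5 (sub_nonneg.2 hP)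
    -- Bounding `tr G²` below by `t²/q` leaves `(p - q - 2)/q - 1`; the `-1` comes from `-(tr G)²`
    -- and accounts for the second `q` in `p - 2q - 2`.
    have h7 : (P.trace - 2 * Fintype.card k - 2) / Fintype.card k * t1 ^ 2 =
        (P.trace - (Fintype.card k + 2)) * (t1 ^ 2 / Fintype.card k) - t1 ^ 2 := by
      field_simp
      ring
    have h8 : 0 ≤ 2 * ε * t3 := by positivity
    have h9 : 0 ≤ 2 * ε * t1 * t2 := by positivity
    rw [h7]
    linarith

end Matrix

/-! ### Removing the regularization -/

/-- If `c E t² ≤ E (t D)`, subtracting `c t` from `D` lowers its mean square by at least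
`c² E t²`. -/
theorem lintegral_sub_sq_add_le {Ω : Type*} [MeasurableSpace Ω] {μ : Measure Ω} {D t : Ω → ℝ}
    {c : ℝ} (hc : 0 ≤ c) (hD : HasAllMoments D μ) (ht : HasAllMoments t μ)
    (h : c * ∫ w, t w ^ 2 ∂μ ≤ ∫ w, t w * D w ∂μ) :
    ∫⁻ w, ENNReal.ofReal ((D w - c * t w) ^ 2 + c ^ 2 * t w ^ 2) ∂μ ≤
      ∫⁻ w, ENNReal.ofReal (D w ^ 2) ∂μ := by
  have iDD : Integrable (fun w => D w ^ 2) μ := by simpa only [sq] using (hD.mul hD).integrable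
  have itt : Integrable (fun w => t w ^ 2) μ := by simpa only [sq] using (ht.mul ht).integrable
  have itD : Integrable (fun w => t w * D w) μ := (ht.mul hD).integrable
  have e : ∀ w, (D w - c * t w) ^ 2 + c ^ 2 * t w ^ 2 =
      D w ^ 2 - 2 * c * (t w * D w) + 2 * c ^ 2 * t w ^ 2 := fun w => by ring
  have i1 : Integrable (fun w => D w ^ 2 - 2 * c * (t w * D w)) μ := iDD.sub (itD.const_mul _)
  have i2 : Integrable (fun w => 2 * c ^ 2 * t w ^ 2) μ := itt.const_mul _
  rw [← ofReal_integral_eq_lintegral_ofReal _ (ae_of_all _ fun w => by positivity),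
    ← ofReal_integral_eq_lintegral_ofReal iDD (ae_of_all _ fun w => sq_nonneg _)]
  · refine ENNReal.ofReal_le_ofReal ?_
    simp only [e]
    rw [integral_add i1 i2, integral_sub iDD (itD.const_mul _), integral_const_mul,
      integral_const_mul]
    have := mul_le_mul_of_nonneg_left h hc
    nlinarith
  · simp only [e]
    exact i1.add i2

/-- If the random variables `t n` blow up on an event and have bounded second moments, the event is
null. -/
theorem ae_not_of_lintegral_sq_le {Ω : Type*} [MeasurableSpace Ω] {μ : Measure Ω}
    {f : ℕ → Ω → ℝ≥0∞} (hf : ∀ n, Measurable (f n)) {K : ℝ≥0∞} (hK : K ≠ ∞)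
    (h : ∀ n, ∫⁻ w, f n w ∂μ ≤ K) {p : Ω → Prop}
    (hp : ∀ w, p w → Filter.Tendsto (fun n => f n w) Filter.atTop (nhds ∞)) :
    ∀ᵐ w ∂μ, ¬ p w := by
  have h1 : ∫⁻ w, Filter.liminf (fun n => f n w) Filter.atTop ∂μ ≤ K :=
    (lintegral_liminf_le hf).trans
      ((Filter.liminf_le_liminf (Filter.Eventually.of_forall h)).trans (by simp))
  have h2 := ae_lt_top (Measurable.liminf hf) (h1.trans_lt hK.lt_top).ne
  filter_upwards [h2] with w hw hpw
  rw [(hp w hpw).liminf_eq] at hw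
  exact lt_irrefl _ hw

/-- A limit of corrections `c * t n`, each satisfying `c E (t n)² ≤ E (t n D)`, strictly reduces the
mean square of `D` as soon as the limit does not vanish. -/
theorem lintegral_sub_sq_lt {Ω : Type*} [MeasurableSpace Ω] {μ : Measure Ω} [NeZero μ] {D : Ω → ℝ}
    {t : ℕ → Ω → ℝ} {T : Ω → ℝ} {c : ℝ} (hc : 0 < c) (hD : HasAllMoments D μ) (hDm : Measurable D)
    (ht : ∀ n, HasAllMoments (t n) μ) (htm : ∀ n, Measurable (t n)) (hTm : Measurable T)
    (h : ∀ n, c * ∫ w, t n w ^ 2 ∂μ ≤ ∫ w, t n w * D w ∂μ)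
    (hT : ∀ w, T w ≤ 0 → Filter.Tendsto (fun n => t n w) Filter.atTop Filter.atTop)
    (htT : ∀ w, 0 < T w → Filter.Tendsto (fun n => t n w) Filter.atTop (nhds (T w))) :
    ∫⁻ w, ENNReal.ofReal ((D w - c * T w) ^ 2) ∂μ < ∫⁻ w, ENNReal.ofReal (D w ^ 2) ∂μ := by
  set K := ∫⁻ w, ENNReal.ofReal (D w ^ 2) ∂μ with hKdef
  have iDD : Integrable (fun w => D w ^ 2) μ := by simpa only [sq] using (hD.mul hD).integrable
  have hK : K ≠ ∞ := by
    rw [hKdef, ← ofReal_integral_eq_lintegral_ofReal iDD (ae_of_all _ fun w => sq_nonneg _)]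
    exact ENNReal.ofReal_ne_top
  have hle := fun n => lintegral_sub_sq_add_le hc.le hD (ht n) (h n)
  have hfm : ∀ n, Measurable fun w =>
      ENNReal.ofReal ((D w - c * t n w) ^ 2 + c ^ 2 * t n w ^ 2) := fun n =>
    (((hDm.sub ((htm n).const_mul c)).pow_const 2).add
      (((htm n).pow_const 2).const_mul (c ^ 2))).ennreal_ofReal
  -- The surplus `c² t²` bounds the second moments of `t n` uniformly, so blow-up has probability
  -- zero.
  have hpos : ∀ᵐ w ∂μ, 0 < T w := by
    have := ae_not_of_lintegral_sq_le hfm hK hle (p := fun w => T w ≤ 0) fun w hw => by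
      refine ENNReal.tendsto_ofReal_nhds_top.2 (Filter.tendsto_atTop_mono (f := fun n => c ^ 2 * t n w ^ 2)
        (fun n => ?_) ?_)
      · have := sq_nonneg (D w - c * t n w)
        linarith
      · exact ((Filter.tendsto_pow_atTop two_ne_zero).comp (hT w hw)).const_mul_atTop (by positivity)
    filter_upwards [this] with w hw
    exact not_le.1 hw
  -- Fatou again, keeping the surplus `c² T²`, which supplies strictness.
  have hlim : ∫⁻ w, ENNReal.ofReal ((D w - c * T w) ^ 2 + c ^ 2 * T w ^ 2) ∂μ ≤ K := by
    calc _ = ∫⁻ w, Filter.liminf (fun n =>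
            ENNReal.ofReal ((D w - c * t n w) ^ 2 + c ^ 2 * t n w ^ 2)) Filter.atTop ∂μ := by
          refine lintegral_congr_ae ?_
          filter_upwards [hpos] with w hw
          have h1 := htT w hw
          exact ((ENNReal.tendsto_ofReal (((tendsto_const_nhds.sub (h1.const_mul c)).pow 2).add
            ((h1.pow 2).const_mul (c ^ 2)))).liminf_eq).symm
      _ ≤ _ := (lintegral_liminf_le hfm).trans
          ((Filter.liminf_le_liminf (Filter.Eventually.of_forall hle)).trans (by simp [hKdef]))
  have hsplit : ∀ w, ENNReal.ofReal ((D w - c * T w) ^ 2 + c ^ 2 * T w ^ 2) =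
      ENNReal.ofReal ((D w - c * T w) ^ 2) + ENNReal.ofReal (c ^ 2 * T w ^ 2) := fun w =>
    ENNReal.ofReal_add (sq_nonneg _) (by positivity)
  have hTm2 : Measurable fun w => ENNReal.ofReal (c ^ 2 * T w ^ 2) :=
    ((hTm.pow_const 2).const_mul _).ennreal_ofReal
  simp only [hsplit] at hlim
  rw [lintegral_add_right _ hTm2] at hlim
  have hne : ∫⁻ w, ENNReal.ofReal (c ^ 2 * T w ^ 2) ∂μ ≠ 0 := by
    intro h0
    rw [lintegral_eq_zero_iff hTm2] at h0
    have : ∀ᵐ _ ∂μ, False := by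
      filter_upwards [h0, hpos] with w h1 h2
      simp only [Pi.zero_apply, ENNReal.ofReal_eq_zero] at h1
      have : 0 < c ^ 2 * T w ^ 2 := by positivity
      linarith
    simp [NeZero.ne] at this
  refine lt_of_lt_of_le (ENNReal.lt_add_right ?_ hne) hlim
  exact ((le_self_add.trans hlim).trans_lt hK.lt_top).ne

namespace Matrix

variable {m k : Type*} [Fintype m] [DecidableEq m] [Fintype k] [DecidableEq k]
  {ε : ℝ} {M : Matrix m k ℝ} {P : Matrix m m ℝ}

omit [DecidableEq m] [DecidableEq k] in
theorem measurable_quadratic (A : Matrix m m ℝ) (κ : ℝ) :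
    Measurable fun w : m × k → ℝ => ((ofPairs w)ᵀ * (A * ofPairs w)).trace + κ := by
  have hN : ∀ i j, Measurable fun w : m × k → ℝ => ofPairs w i j :=
    fun i j => measurable_pi_apply (i, j)
  have hA := measurable_matrix_mul_apply (U := fun _ : m × k → ℝ => A)
    (V := fun w : m × k → ℝ => ofPairs w) (fun _ _ => measurable_const) hN
  have hQ := measurable_matrix_mul_apply (U := fun w : m × k → ℝ => (ofPairs w)ᵀ)
    (fun i j => hN j i) hA
  exact (Finset.measurable_sum Finset.univ fun a _ => hQ a a).add_const κ

omit [DecidableEq m] [DecidableEq k] in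
theorem hasAllMoments_quadratic (A : Matrix m m ℝ) (κ : ℝ) :
    HasAllMoments (fun w : m × k → ℝ => ((ofPairs w)ᵀ * (A * ofPairs w)).trace + κ)
      (Measure.pi fun _ => gaussianReal 0 1) :=
  (HasAllMoments.trace (HasAllMoments.matrix_mul (U := fun w : m × k → ℝ => (ofPairs w)ᵀ)
    (fun i j => hasAllMoments_ofPairs j i) (hasAllMoments_const_mul_ofPairs A))).add
    (HasAllMoments.const κ)

/-- The correction `c tr (ZᵀZ)⁻¹` strictly improves the error of the unbiased estimate. -/
theorem lintegral_sub_trace_inv_sq_lt (hPt : Pᵀ = P) (hPP : P * P = P)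
    (hPM : P * M = M) [Nonempty k] {c κ : ℝ}
    (hP : 2 * (Fintype.card k : ℝ) + 2 < P.trace)
    (hc : c = 2 * (P.trace - 2 * Fintype.card k - 2) / Fintype.card k)
    (hκ : κ = (2 * P.trace - Fintype.card m) * Fintype.card k) :
    ∫⁻ w, ENNReal.ofReal
        ((((ofPairs w)ᵀ * ((1 - (2 : ℝ) • P) * ofPairs w)).trace + κ -
          c * (((M + P * ofPairs w)ᵀ * (M + P * ofPairs w))⁻¹).trace) ^ 2)
        ∂(Measure.pi fun _ : m × k => gaussianReal 0 1) <
      ∫⁻ w, ENNReal.ofReal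
        ((((ofPairs w)ᵀ * ((1 - (2 : ℝ) • P) * ofPairs w)).trace + κ) ^ 2)
        ∂(Measure.pi fun _ : m × k => gaussianReal 0 1) := by
  have hk : (0 : ℝ) < Fintype.card k := by exact_mod_cast Fintype.card_pos
  have hc0 : 0 < c := by
    rw [hc]
    exact div_pos (by linarith) hk
  have hZm := measurable_proj_ofPairs (M := M) (P := P)
  have hε : ∀ n : ℕ, (0 : ℝ) < 1 / ((n : ℝ) + 1) := fun n => by positivity
  have hunit : ∀ Z : Matrix m k ℝ, IsUnit (Zᵀ * Z) → 0 < ((Zᵀ * Z)⁻¹).trace := by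
    intro Z hZ
    have h1 := posSemidef_conjTranspose_mul_self Z
    rw [conjTranspose_eq_transpose_of_trivial] at h1
    exact (h1.posDef_iff_isUnit.2 hZ).inv.trace_pos
  -- The inverse of a singular matrix is `0` by convention, so the sign of `T` detects
  -- invertibility.
  have hsing : ∀ Z : Matrix m k ℝ, ¬ IsUnit (Zᵀ * Z) → ((Zᵀ * Z)⁻¹).trace = 0 := by
    intro Z hZ
    rw [nonsing_inv_apply_not_isUnit _ (fun h => hZ ((isUnit_iff_isUnit_det _).2 h)), trace_zero]
  refine lintegral_sub_sq_lt
    (t := fun (n : ℕ) w => (gramResolvent (1 / ((n : ℝ) + 1)) (M + P * ofPairs w)).trace)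
    hc0 (hasAllMoments_quadratic _ κ) (measurable_quadratic _ κ)
    (fun n => HasAllMoments.trace (hasAllMoments_gramResolvent (hε n)))
    (fun n => Finset.measurable_sum _ fun a _ => measurable_gramResolvent_apply hZm _ a a)
    (Finset.measurable_sum _ fun a _ => measurable_matrix_inv_apply
      (measurable_matrix_mul_apply (U := fun w => (M + P * ofPairs w)ᵀ) (fun i j => hZm j i) hZm)
      a a) (fun n => ?_) (fun w hw => ?_) (fun w hw => ?_)
  · rw [hc, hκ]
    exact le_integral_trace_gramResolvent_mul (hε n) hPt hPP hPM Fintype.card_pos (by linarith)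
  · have hns : ¬ IsUnit ((M + P * ofPairs w)ᵀ * (M + P * ofPairs w)) :=
      fun h => absurd (hunit _ h) (not_lt.2 hw)
    refine Filter.tendsto_atTop_mono (f := fun n : ℕ => (n : ℝ) + 1) (fun n => ?_)
      (Filter.tendsto_atTop_add_const_right _ _ tendsto_natCast_atTop_atTop)
    refine le_trans (le_of_eq ?_) (inv_le_trace_gramResolvent (hε n) _ hns)
    rw [one_div, inv_inv]
  · refine tendsto_gramResolvent_trace ?_ tendsto_one_div_add_atTop_nhds_zero_nat
    by_contra h
    rw [hsing _ h] at hw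
    exact lt_irrefl _ hw

end Matrix

/-! ### The regression law as an image of independent standard Gaussians -/

open scoped MatrixOrder in
theorem multivariateGaussian_zero_eq_map_pi {k : Type*} [Fintype k] [DecidableEq k]
    (S : Matrix k k ℝ) :
    multivariateGaussian (0 : EuclideanSpace ℝ k) S =
      (Measure.pi fun _ : k => gaussianReal 0 1).map
        fun z => WithLp.toLp 2 (CFC.sqrt S *ᵥ z) := by
  rw [multivariateGaussian, ← map_pi_eq_stdGaussian, Measure.map_map (by fun_prop) (by fun_prop)]
  congr 1
  ext z i
  simp

theorem pi_map_curry_pi {ι κ α : Type*} [Fintype ι] [Fintype κ] [MeasurableSpace α]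
    (μ : Measure α) [IsProbabilityMeasure μ] :
    (Measure.pi fun _ : ι × κ => μ).map (fun w i j => w (i, j)) =
      Measure.pi fun _ : ι => Measure.pi fun _ : κ => μ := by
  have h := Measure.infinitePi_map_curry (ι := ι) (κ := κ) fun _ _ => μ
  simp only [Measure.infinitePi_eq_pi] at h
  exact h

theorem measurable_matrix_iff {Ω m k : Type*} [MeasurableSpace Ω] {f : Ω → Matrix m k ℝ} :
    Measurable f ↔ ∀ i j, Measurable fun w => f w i j := by
  refine Iff.trans measurable_pi_iff (forall_congr' fun i => ?_)
  exact measurable_pi_iff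

namespace LossEstimation

open scoped MatrixOrder

variable {n p q : ℕ}

/-- In the regression model, `Y = X B + N Σ^{1/2}` where `N` has independent standard Gaussian
entries. -/
theorem regressionLaw_eq_map (X : Matrix (Fin n) (Fin p) ℝ) (S : Matrix (Fin q) (Fin q) ℝ)
    (B : Matrix (Fin p) (Fin q) ℝ) :
    regressionLaw X S B = (Measure.pi fun _ : Fin n × Fin q => gaussianReal 0 1).map
      fun w => X * B + ofPairs w * CFC.sqrt S := by
  have hg : Measurable fun z : Fin q → ℝ =>
      (WithLp.toLp 2 (CFC.sqrt S *ᵥ z) : EuclideanSpace ℝ (Fin q)) := by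
    have : Continuous fun z : Fin q → ℝ => CFC.sqrt S *ᵥ z :=
      Continuous.matrix_mulVec continuous_const continuous_id
    fun_prop
  have hpi : (Measure.pi fun _ : Fin n => multivariateGaussian (0 : EuclideanSpace ℝ (Fin q)) S) =
      (Measure.pi fun _ : Fin n × Fin q => gaussianReal 0 1).map
        fun w i => WithLp.toLp 2 (CFC.sqrt S *ᵥ fun j => w (i, j)) := by
    simp only [multivariateGaussian_zero_eq_map_pi]
    rw [← Measure.pi_map_pi (fun _ => hg.aemeasurable), ← pi_map_curry_pi,
      Measure.map_map (by fun_prop) (by fun_prop)]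
    rfl
  rw [regressionLaw, hpi, Measure.map_map]
  · congr 1
    ext w i j
    -- Row `i` of the noise is `R zᵢ`, a row of `N Rᵀ`; symmetry of `R` makes this `N R`.
    have hR := transpose_sqrt S
    generalize CFC.sqrt S = R at hR
    simp only [Function.comp, of_apply, Matrix.add_apply, mulVec, dotProduct, mul_apply, transpose_apply,
      ofPairs]
    congr 1
    · exact Finset.sum_congr rfl fun _ _ => mul_comm _ _
    · refine Finset.sum_congr rfl fun l _ => ?_
      rw [mul_comm, ← hR, transpose_apply, hR]
  · refine measurable_matrix_iff.2 fun i j => ?_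
    simp only [of_apply]
    fun_prop
  · exact measurable_pi_iff.2 fun i => hg.comp (by fun_prop)

/-! ### The hat matrix and SURE in standardized form -/

/-- The orthogonal projection onto the column space of the design matrix. -/
noncomputable def hatMatrix (X : Matrix (Fin n) (Fin p) ℝ) : Matrix (Fin n) (Fin n) ℝ :=
  X * (Xᵀ * X)⁻¹ * Xᵀ

variable {X : Matrix (Fin n) (Fin p) ℝ} {S : Matrix (Fin q) (Fin q) ℝ}

theorem mul_mle (X : Matrix (Fin n) (Fin p) ℝ) (Y : Matrix (Fin n) (Fin q) ℝ) :
    X * mle X Y = hatMatrix X * Y := by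
  simp only [mle, hatMatrix, Matrix.mul_assoc]

theorem hatMatrix_transpose (X : Matrix (Fin n) (Fin p) ℝ) : (hatMatrix X)ᵀ = hatMatrix X := by
  simp only [hatMatrix, transpose_mul, transpose_transpose, transpose_nonsing_inv, Matrix.mul_assoc]

theorem hatMatrix_mul_self (hX : IsUnit (Xᵀ * X)) : hatMatrix X * X = X := by
  rw [hatMatrix, Matrix.mul_assoc, Matrix.mul_assoc,
    nonsing_inv_mul _ ((isUnit_iff_isUnit_det _).1 hX), Matrix.mul_one]

theorem hatMatrix_idempotent (hX : IsUnit (Xᵀ * X)) : hatMatrix X * hatMatrix X = hatMatrix X := by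
  conv_lhs => rw [hatMatrix.eq_def X, ← Matrix.mul_assoc, ← Matrix.mul_assoc,
    ← hatMatrix.eq_def X, hatMatrix_mul_self hX]
  rw [hatMatrix]

theorem trace_hatMatrix (hX : IsUnit (Xᵀ * X)) : (hatMatrix X).trace = p := by
  rw [hatMatrix, trace_mul_comm, ← Matrix.mul_assoc,
    mul_nonsing_inv _ ((isUnit_iff_isUnit_det _).1 hX), trace_one, Fintype.card_fin]

/-- Here `g(Y) = (P - 1)Y` is linear, so each partial derivative is the constant `Pᵢᵢ - 1` and the
divergence is `q(p - n)`. -/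
theorem sure_eq (hX : IsUnit (Xᵀ * X)) (S : Matrix (Fin q) (Fin q) ℝ)
    (Y : Matrix (Fin n) (Fin q) ℝ) :
    sure S (fun Z => X * mle X Z) Y =
      (S⁻¹ * (Y - X * mle X Y)ᵀ * (Y - X * mle X Y)).trace + (2 * (p : ℝ) - n) * q := by
  simp only [sure, mul_mle]
  have hd : ∀ i j, deriv (fun t : ℝ => (hatMatrix X * (Y + t • (single i j (1 : ℝ) : Matrix (Fin n) (Fin q) ℝ)) -
      (Y + t • (single i j (1 : ℝ) : Matrix (Fin n) (Fin q) ℝ))) i j) 0 = hatMatrix X i i - 1 := by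
    intro i j
    have h1 : ∀ t : ℝ, (hatMatrix X * (Y + t • single i j (1 : ℝ)) -
        (Y + t • single i j (1 : ℝ))) i j =
        (hatMatrix X * Y - Y) i j + t * (hatMatrix X i i - 1) := by
      intro t
      rw [Matrix.mul_add, Matrix.mul_smul]
      simp only [Matrix.sub_apply, Matrix.add_apply, Matrix.smul_apply, smul_eq_mul, single_apply_same]
      simp
      ring
    simp only [h1]
    simp
  have hs : ∑ i : Fin n, ∑ _j : Fin q, (hatMatrix X i i - 1) = q * (p - n) := by
    rw [← trace_hatMatrix hX]
    simp only [Finset.sum_const, Finset.card_univ, Fintype.card_fin, nsmul_eq_mul,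
      ← Finset.mul_sum, Finset.sum_sub_distrib, trace, diag_apply, mul_one]
  simp only [hd, hs]
  rw [← neg_sub Y, transpose_neg, Matrix.mul_neg, Matrix.mul_neg, Matrix.neg_mul, neg_neg]
  ring

theorem measurable_quadForm {A : Matrix (Fin q) (Fin q) ℝ}
    {f : Matrix (Fin n) (Fin q) ℝ → Matrix (Fin n) (Fin q) ℝ} (hf : ∀ i j, Measurable fun Y => f Y i j) :
    Measurable fun Y => (A * (f Y)ᵀ * f Y).trace :=
  Finset.measurable_sum _ fun a _ => measurable_matrix_mul_apply (U := fun Y => A * (f Y)ᵀ)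
    (measurable_matrix_mul_apply (U := fun _ => A) (V := fun Y => (f Y)ᵀ)
      (fun _ _ => measurable_const) fun i j => hf j i) hf a a

theorem measurable_apply (i : Fin n) (j : Fin q) :
    Measurable fun Y : Matrix (Fin n) (Fin q) ℝ => Y i j :=
  measurable_matrix_iff.1 measurable_id i j

theorem measurable_mul_mle (X : Matrix (Fin n) (Fin p) ℝ) (i : Fin n) (j : Fin q) :
    Measurable fun Y : Matrix (Fin n) (Fin q) ℝ => (X * mle X Y) i j := by
  simp only [mul_mle]
  exact measurable_matrix_mul_apply (U := fun _ => hatMatrix X) (V := fun Y => Y)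
    (fun _ _ => measurable_const) measurable_apply i j

theorem measurable_sure (hX : IsUnit (Xᵀ * X)) (S : Matrix (Fin q) (Fin q) ℝ) :
    Measurable (sure S fun Z : Matrix (Fin n) (Fin q) ℝ => X * mle X Z) := by
  rw [funext (sure_eq hX S)]
  exact (measurable_quadForm fun i j =>
    (measurable_apply i j).sub (measurable_mul_mle X i j)).add_const _

theorem measurable_modifiedSure (hX : IsUnit (Xᵀ * X)) (S : Matrix (Fin q) (Fin q) ℝ) :
    Measurable (modifiedSure (n := n) X S) := by
  refine (measurable_sure hX S).sub (Measurable.const_mul ?_ _)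
  refine Finset.measurable_sum _ fun a _ => ?_
  exact measurable_matrix_mul_apply (U := fun _ => S) (fun _ _ => measurable_const)
    (measurable_matrix_inv_apply (measurable_matrix_mul_apply (U := fun Y => (X * mle X Y)ᵀ)
      (fun i j => measurable_mul_mle X j i) (measurable_mul_mle X))) a a

theorem measurable_quadLoss (X : Matrix (Fin n) (Fin p) ℝ) (S : Matrix (Fin q) (Fin q) ℝ)
    (M : Matrix (Fin n) (Fin q) ℝ) :
    Measurable fun Y : Matrix (Fin n) (Fin q) ℝ => quadLoss S M (X * mle X Y) :=
  measurable_quadForm fun i j => (measurable_mul_mle X i j).sub_const _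

theorem isUnit_sqrt (hS : S.PosDef) : IsUnit (CFC.sqrt S) :=
  isUnit_of_mul_isUnit_left (hS.posSemidef.sqrt_mul_sqrt ▸ hS.isUnit)

theorem trace_inv_mul_sqrt_sandwich (hS : S.PosDef) (A : Matrix (Fin q) (Fin q) ℝ) :
    (S⁻¹ * (CFC.sqrt S * A * CFC.sqrt S)).trace = A.trace := by
  have hR := (isUnit_iff_isUnit_det _).1 (isUnit_sqrt hS)
  have hS2 := hS.posSemidef.sqrt_mul_sqrt
  have hi : S⁻¹ = (CFC.sqrt S)⁻¹ * (CFC.sqrt S)⁻¹ := by rw [← Matrix.mul_inv_rev, hS2]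
  rw [hi, Matrix.mul_assoc, Matrix.mul_assoc (CFC.sqrt S), nonsing_inv_mul_cancel_left _ _ hR,
    trace_mul_comm, Matrix.mul_assoc, mul_nonsing_inv _ hR, Matrix.mul_one]

/-- The estimation error of SURE is a quadratic form in the standardized errors. -/
theorem sure_sub_quadLoss (hX : IsUnit (Xᵀ * X)) (hS : S.PosDef) (B : Matrix (Fin p) (Fin q) ℝ)
    (N : Matrix (Fin n) (Fin q) ℝ) :
    sure S (fun Z => X * mle X Z) (X * B + N * CFC.sqrt S) -
        quadLoss S (X * B) (X * mle X (X * B + N * CFC.sqrt S)) =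
      (Nᵀ * ((1 - (2 : ℝ) • hatMatrix X) * N)).trace + (2 * (p : ℝ) - n) * q := by
  have hPt := hatMatrix_transpose X
  have hPP := hatMatrix_idempotent hX
  have hPX := hatMatrix_mul_self hX
  have hRt := transpose_sqrt S
  have hsand := trace_inv_mul_sqrt_sandwich hS
  rw [sure_eq hX, quadLoss, mul_mle]
  set P := hatMatrix X
  set R := CFC.sqrt S
  have e1 : P * (X * B + N * R) = X * B + P * N * R := by
    rw [Matrix.mul_add, ← Matrix.mul_assoc, hPX, Matrix.mul_assoc]
  have e2 : X * B + N * R - (X * B + P * N * R) = (1 - P) * N * R := by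
    rw [add_sub_add_left_eq_sub, Matrix.sub_mul, Matrix.one_mul, Matrix.sub_mul]
  -- Used for `Q = 1 - P` (residual) and `Q = P` (estimation error).
  have e3 : ∀ Q : Matrix (Fin n) (Fin n) ℝ, Qᵀ = Q → Q * Q = Q →
      (S⁻¹ * (Q * N * R)ᵀ * (Q * N * R)).trace = (Nᵀ * (Q * N)).trace := by
    intro Q hQt hQQ
    rw [← hsand (Nᵀ * (Q * N))]
    congr 1
    simp only [transpose_mul, hRt, hQt, Matrix.mul_assoc]
    rw [← Matrix.mul_assoc Q Q, hQQ]
  rw [e1, e2, add_sub_cancel_left, e3 (1 - P) (by rw [transpose_sub, transpose_one, hPt])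
    (by rw [Matrix.sub_mul, Matrix.one_mul, Matrix.mul_sub, hPP, Matrix.mul_one, sub_self, sub_zero]),
    e3 P hPt hPP]
  have e4 : (1 - (2 : ℝ) • P) * N = (1 - P) * N - P * N := by
    rw [two_smul, Matrix.sub_mul, Matrix.sub_mul, Matrix.add_mul, sub_sub]
  rw [e4, Matrix.mul_sub, trace_sub]
  ring

/-- `XB̂ = Z Σ^{1/2}`, so `Σ` cancels under the trace. Invertibility of `ZᵀZ` is not needed, since
reversing the inverse of a product holds for all matrices under the convention for singular ones. -/
theorem trace_mul_inv_gram_mle (hX : IsUnit (Xᵀ * X)) (hS : S.PosDef)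
    (B : Matrix (Fin p) (Fin q) ℝ) (N : Matrix (Fin n) (Fin q) ℝ) :
    (S * ((X * mle X (X * B + N * CFC.sqrt S))ᵀ * (X * mle X (X * B + N * CFC.sqrt S)))⁻¹).trace =
      (((X * B * (CFC.sqrt S)⁻¹ + hatMatrix X * N)ᵀ *
        (X * B * (CFC.sqrt S)⁻¹ + hatMatrix X * N))⁻¹).trace := by
  have hR := (isUnit_iff_isUnit_det _).1 (isUnit_sqrt hS)
  have hRt := transpose_sqrt S
  have hS2 := hS.posSemidef.sqrt_mul_sqrt
  set Z := X * B * (CFC.sqrt S)⁻¹ + hatMatrix X * N with hZ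
  have e1 : X * mle X (X * B + N * CFC.sqrt S) = Z * CFC.sqrt S := by
    rw [mul_mle, Matrix.mul_add, ← Matrix.mul_assoc, hatMatrix_mul_self hX, hZ, Matrix.add_mul,
      nonsing_inv_mul_cancel_right _ _ hR, Matrix.mul_assoc]
  have e2 : (Z * CFC.sqrt S)ᵀ * (Z * CFC.sqrt S) = CFC.sqrt S * (Zᵀ * Z) * CFC.sqrt S := by
    rw [transpose_mul, hRt]
    simp only [Matrix.mul_assoc]
  rw [e1, e2, Matrix.mul_inv_rev, Matrix.mul_inv_rev]
  generalize (Zᵀ * Z)⁻¹ = W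
  generalize CFC.sqrt S = R at *
  rw [← hS2, Matrix.mul_assoc, mul_nonsing_inv_cancel_left _ _ hR, ← Matrix.mul_assoc,
    trace_mul_comm, nonsing_inv_mul_cancel_left _ _ hR]

theorem mse_regressionLaw (X : Matrix (Fin n) (Fin p) ℝ) (S : Matrix (Fin q) (Fin q) ℝ)
    (B : Matrix (Fin p) (Fin q) ℝ) {l : Matrix (Fin n) (Fin q) ℝ → ℝ} (hl : Measurable l) :
    mse (regressionLaw X S) (fun B Y => quadLoss S (X * B) (X * mle X Y)) l B =
      ∫⁻ w, ENNReal.ofReal ((l (X * B + ofPairs w * CFC.sqrt S) -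
        quadLoss S (X * B) (X * mle X (X * B + ofPairs w * CFC.sqrt S))) ^ 2)
        ∂(Measure.pi fun _ : Fin n × Fin q => gaussianReal 0 1) := by
  rw [mse, regressionLaw_eq_map, lintegral_map]
  · exact ((hl.sub (measurable_quadLoss X S (X * B))).pow_const 2).ennreal_ofReal
  · refine measurable_matrix_iff.2 fun i j => Measurable.const_add ?_ _
    exact measurable_matrix_mul_apply (U := fun w : Fin n × Fin q → ℝ => ofPairs w)
      (V := fun _ => CFC.sqrt S) (fun i j => measurable_pi_apply (i, j))
      (fun _ _ => measurable_const) i j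

/-! ### Conclusion -/

theorem mse_modifiedSure_lt (hq : 1 ≤ q) (hpq : 2 * q + 3 ≤ p) (hX : IsUnit (Xᵀ * X))
    (hS : S.PosDef) (B : Matrix (Fin p) (Fin q) ℝ) :
    mse (regressionLaw X S) (fun B Y => quadLoss S (X * B) (X * mle X Y)) (modifiedSure X S) B <
      mse (regressionLaw X S) (fun B Y => quadLoss S (X * B) (X * mle X Y))
        (sure S fun Z => X * mle X Z) B := by
  have hne : Nonempty (Fin q) := ⟨⟨0, hq⟩⟩
  have hpq' : 2 * (q : ℝ) + 3 ≤ p := by exact_mod_cast hpq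
  have hPM : hatMatrix X * (X * B * (CFC.sqrt S)⁻¹) = X * B * (CFC.sqrt S)⁻¹ := by
    rw [Matrix.mul_assoc X, ← Matrix.mul_assoc, hatMatrix_mul_self hX]
  rw [mse_regressionLaw X S B (measurable_modifiedSure hX S),
    mse_regressionLaw X S B (measurable_sure hX S)]
  have e : ∀ Y : Matrix (Fin n) (Fin q) ℝ,
      modifiedSure X S Y - quadLoss S (X * B) (X * mle X Y) =
        sure S (fun Z => X * mle X Z) Y - quadLoss S (X * B) (X * mle X Y) -
          2 * ((p : ℝ) - 2 * q - 2) / q * (S * ((X * mle X Y)ᵀ * (X * mle X Y))⁻¹).trace :=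
    fun Y => sub_right_comm _ _ _
  simp only [e, sure_sub_quadLoss hX hS, trace_mul_inv_gram_mle hX hS]
  refine lintegral_sub_trace_inv_sq_lt (hatMatrix_transpose X) (hatMatrix_idempotent hX) hPM ?_ ?_ ?_
  all_goals simp only [trace_hatMatrix hX, Fintype.card_fin]
  linarith

end LossEstimation

open LossEstimation in
theorem mainTheorem6 (n p q : ℕ) (hq : 1 ≤ q) (hpq : 2 * q + 3 ≤ p)
    (X : Matrix (Fin n) (Fin p) ℝ) (hX : IsUnit (Xᵀ * X))
    (S : Matrix (Fin q) (Fin q) ℝ) (hS : S.PosDef) :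
    -- the law of `Y` given `B`, the estimator `M̂ = XB̂`, its loss as an estimator of `M = XB`
    let P : Matrix (Fin p) (Fin q) ℝ → Measure (Matrix (Fin n) (Fin q) ℝ) := regressionLaw X S
    let Mhat : Matrix (Fin n) (Fin q) ℝ → Matrix (Fin n) (Fin q) ℝ := fun Y => X * mle X Y
    let L : Matrix (Fin p) (Fin q) ℝ → Matrix (Fin n) (Fin q) ℝ → ℝ :=
      fun B Y => quadLoss S (X * B) (Mhat Y)
    (∀ Y, sure S Mhat Y =
        (S⁻¹ * (Y - Mhat Y)ᵀ * (Y - Mhat Y)).trace + (2 * (p : ℝ) - n) * q) ∧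
      Measurable (sure S Mhat) ∧ Measurable (modifiedSure (n := n) X S) ∧
      Inadmissible P L (sure S Mhat) ∧
      Dominates P L (modifiedSure X S) (sure S Mhat) := by
  intro P Mhat L
  have hlt := mse_modifiedSure_lt hq hpq hX hS
  -- The improvement is strict at every `B`; the witness `0` is arbitrary.
  have hdom : Dominates P L (modifiedSure X S) (sure S Mhat) := ⟨fun B => (hlt B).le, 0, hlt 0⟩
  exact ⟨sure_eq hX S, measurable_sure hX S, measurable_modifiedSure hX S,
    ⟨_, measurable_modifiedSure hX S, hdom⟩, hdom⟩
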